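/- **Conventions.** A *cpo* is a poset in which every increasing sequence $x_0\le x_1\le\cdots$ has a supremum; it is *pointed* if it has a least element $\bot$. A monotone function between cpos is *Scott continuous* if it preserves suprema of increasing sequences; a Scott-continuous function between pointed cpos is *strict* if it preserves $\bot$. Let $\mathbf{CPO}$ be the category of cpos and Scott-continuous functions, with its cartesian products, and let $\mathbf{CPO}_{\bot!}$ be the category of pointed cpos and strict Scott-continuous functions, with the symmetric monoidal closed structure given by the smash product $A\otimes B=\{\bot\}\cup\{(a,b): a\neq\bot\neq b\}$ (componentwise order), the two-element cpo $I=\{\bot<\top\}$ and the strict function space $A\multimap B$ (pointwise order). A *$\mathbf{CPO}$-category* is a category whose hom-sets are cpos and whose composition is Scott continuous; a *$\mathbf{CPO}$-functor* is a functor whose action on hom-cpos is Scott continuous; a *$\mathbf{CPO}$-adjunction* is an adjunction between $\mathbf{CPO}$-functors whose hom-set bijections are isomorphisms of cpos; *$\mathbf{CPO}$-coproducts* and *$\mathbf{CPO}$-products* are coproducts and products whose universal bijections on hom-sets are isomorphisms of cpos. An *embedding* is a morphism $e:A\to B$ for which there is $e^\bullet:B\to A$ with $e^\bullet e=\mathrm{id}_A$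 and $e e^\bullet\le \mathrm{id}_B$ (then $e^\bullet$ is unique). An object is *e-initial* if it is initial and every morphism out of it is an embedding. For a functor $F$, a morphism $f$ is a *pre-embedding with respect to $F$* if $F f$ is an embedding. A *$\mathbf{CPO}$-LNL model* consists of: 1. a $\mathbf{CPO}$-category $\mathbf L$ with finite $\mathbf{CPO}$-coproducts and a symmetric monoidal closed structure $(\otimes,\multimap,I)$ such that $\otimes:\mathbf L\times\mathbf L\to\mathbf L$ and $\multimap:\mathbf L^{\mathrm{op}}\times\mathbf L\to\mathbf L$ are $\mathbf{CPO}$-functors; 2. a $\mathbf{CPO}$-category $\mathbf C$ with finite $\mathbf{CPO}$-products $(\times,1)$ and finite $\mathbf{CPO}$-coproducts; 3. a $\mathbf{CPO}$-adjunction $F\dashv G$, $F:\mathbf C\to\mathbf L$, $G:\mathbf L\to\mathbf C$, which is symmetric monoidal, i.e. $F$ and $G$ are lax symmetric monoidal functors and the unit and the counit are monoidal natural transformations; such that 4. $\mathbf L$ has an e-initial object $0$ and colimits of all $\omega$-diagrams of embeddings, $\mathbf C$ has colimits of all $\omega$-diagrams of pre-embeddings with respect to $F$, and $\times:\mathbf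 C\times\mathbf C\to\mathbf C$ preserves colimits of $\omega$-diagrams whose two components consist of pre-embeddings. In such a model let $\bot_{A,B}:A\to B$ be the composite $A\xrightarrow{e_A^\bullet}0\xrightarrow{e_B}B$, where $e_X:0\to X$ is the unique morphism. The model is *computationally adequate* if $\mathrm{id}_I\neq\bot_{I,I}$ and if, for all $f_1,g_1:I\to A$ and $f_2,g_2:I\to B$ that are all different from the respective morphism $\bot$, $f_1\otimes f_2\le g_1\otimes g_2$ implies $f_1\le g_1$ and $f_2\le g_2$. **Theorem.** With hom-sets ordered pointwise, the adjunction $(-)_\bot\dashv U$ between $\mathbf{CPO}$ and $\mathbf{CPO}_{\bot!}$, where $(-)_\bot:\mathbf{CPO}\to\mathbf{CPO}_{\bot!}$ is lifting (adding a new least element), $U:\mathbf{CPO}_{\bot!}\to\mathbf{CPO}$ is the forgetful functor, and the monoidal structure maps are $x\otimes y\mapsto (x,y)$, $\top\mapsto *$ for $(-)_\bot$ and $(a,b)\mapsto a\otimes b$, $*\mapsto\top$ for $U$, is a $\mathbf{CPO}$-LNL model. Moreover, this model is computationally adequate. -/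

import Mathlib

open CategoryTheory OmegaCompletePartialOrder MonoidalCategory

universe u v u₁ v₁ u₂ v₂

namespace CPOLNL

/-! ### Categories enriched in cpos

The cpos of this development are the posets with suprema of increasing sequences
(`OmegaCompletePartialOrder`), and Scott-continuous functions are the monotone functions that
preserve these suprema (`ωScottContinuous`). -/

/-- A `CPO`-category: a category whose hom-sets are cpos and whose composition is
Scott continuous. -/
class CPOCategory (C : Type u₁) [Category.{v₁} C] where
  /-- the cpo structure on hom-sets -/
  homCPO (X Y : C) : OmegaCompletePartialOrder (X ⟶ Y)
  comp_continuous (X Y Z : C) : ωScottContinuous fun p : (X ⟶ Y) × (Y ⟶ Z) => p.1 ≫ p.2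

attribute [reducible, instance] CPOCategory.homCPO

section Enriched

variable {C : Type u₁} [Category.{v₁} C] [CPOCategory C]
  {L : Type u₂} [Category.{v₂} L] [CPOCategory L]

/-- A `CPO`-functor: its action on hom-cpos is Scott continuous. -/
def IsCPOFunctor (F : C ⥤ L) : Prop :=
  ∀ X Y : C, ωScottContinuous fun f : X ⟶ Y => F.map f

/-- A `CPO`-adjunction between `CPO`-functors: the bijections `L(F X, A) ≃ C(X, G A)` are
isomorphisms of cpos. -/
structure IsCPOAdjunction {F : C ⥤ L} {G : L ⥤ C} (adj : F ⊣ G) : Prop where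
  left_functor : IsCPOFunctor F
  right_functor : IsCPOFunctor G
  homEquiv_continuous : ∀ (X : C) (A : L), ωScottContinuous (adj.homEquiv X A)
  homEquiv_symm_continuous : ∀ (X : C) (A : L), ωScottContinuous (adj.homEquiv X A).symm

/-- Embedding-projection pairs. -/
def IsEPPair {X Y : C} (e : X ⟶ Y) (p : Y ⟶ X) : Prop := e ≫ p = 𝟙 X ∧ p ≫ e ≤ 𝟙 Y

/-- Embeddings: the morphisms that are part of an embedding-projection pair. -/
def IsEmbedding {X Y : C} (e : X ⟶ Y) : Prop := ∃ p : Y ⟶ X, IsEPPair e p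

/-- Pre-embeddings with respect to a functor `F`. -/
def IsPreEmbedding (F : C ⥤ L) {X Y : C} (f : X ⟶ Y) : Prop := IsEmbedding (F.map f)

variable (C) in
/-- Finite `CPO`-coproducts: all finite coproducts exist, and the bijections
`∏ⱼ C(Xⱼ, Z) ≃ C(∐ⱼ Xⱼ, Z)` are Scott continuous (their inverses always are, being given by
precomposition). -/
def HasFiniteCPOCoproducts : Prop :=
  ∀ (J : Type) [Finite J] (X : J → C), ∃ (c : Limits.Cofan X) (hc : Limits.IsColimit c),
    ∀ Z : C, ωScottContinuous fun f : ∀ j, X j ⟶ Z => Limits.Cofan.IsColimit.desc hc f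

variable (C) in
/-- A `CPO`-cartesian monoidal category: a cartesian monoidal category whose product is a
`CPO`-functor and whose pairing bijections `C(Z, X) × C(Z, Y) ≃ C(Z, X × Y)` are Scott
continuous. -/
structure IsCPOCartesianMonoidal [CartesianMonoidalCategory C] : Prop where
  prod_continuous : ∀ X X' Y Y' : C,
    ωScottContinuous fun p : (X ⟶ X') × (Y ⟶ Y') => p.1 ⊗ₘ p.2
  lift_continuous : ∀ X Y Z : C,
    ωScottContinuous fun p : (Z ⟶ X) × (Z ⟶ Y) => CartesianMonoidalCategory.lift p.1 p.2

variable (L) in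
/-- A `CPO`-symmetric monoidal closed category: a symmetric monoidal closed category whose tensor
product `L × L ⥤ L` and internal hom `Lᵒᵖ × L ⥤ L` are `CPO`-functors. -/
structure IsCPOSymmetricMonoidalClosed [MonoidalCategory L] [SymmetricCategory L]
    [MonoidalClosed L] : Prop where
  tensor_continuous : ∀ X X' Y Y' : L,
    ωScottContinuous fun p : (X ⟶ X') × (Y ⟶ Y') => p.1 ⊗ₘ p.2
  ihom_continuous : ∀ X X' Y Y' : L,
    ωScottContinuous fun p : (X' ⟶ X) × (Y ⟶ Y') =>
      (MonoidalClosed.pre p.1).app Y ≫ (ihom X').map p.2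

variable (L) in
/-- An e-initial object: an initial object such that all morphisms out of it are embeddings. -/
structure EInitial where
  /-- the object -/
  obj : L
  /-- it is initial -/
  isInitial : Limits.IsInitial obj
  isEmbedding : ∀ {A : L} (f : obj ⟶ A), IsEmbedding f

/-- The morphism `⊥_{A,B} : A ⟶ 0 ⟶ B`, the projection corresponding to the embedding `0 ⟶ A`
followed by `0 ⟶ B`. -/
noncomputable def EInitial.botHom (Z : EInitial L) (A B : L) : A ⟶ B :=
  (Z.isEmbedding (Z.isInitial.to A)).choose ≫ Z.isInitial.to B

variable [CartesianMonoidalCategory C] [BraidedCategory C] [MonoidalCategory L]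
  [SymmetricCategory L] [MonoidalClosed L]

/-- `CPO`-LNL models. The data are the `CPO`-categories `C` and `L`, the cartesian monoidal
structure of `C`, the symmetric monoidal closed structure of `L`, and the adjunction `F ⊣ G`
between (lax) symmetric monoidal functors. -/
structure IsCPOLNLModel {F : C ⥤ L} {G : L ⥤ C} [F.LaxBraided] [G.LaxBraided] (adj : F ⊣ G) :
    Prop where
  linear : IsCPOSymmetricMonoidalClosed L
  linear_coproducts : HasFiniteCPOCoproducts L
  cartesian : IsCPOCartesianMonoidal C
  cartesian_coproducts : HasFiniteCPOCoproducts C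
  adjunction : IsCPOAdjunction adj
  unit_monoidal : NatTrans.IsMonoidal adj.unit
  counit_monoidal : NatTrans.IsMonoidal adj.counit
  eInitial : Nonempty (EInitial L)
  /-- `L` has all `ω`-colimits over embeddings -/
  colimits_embeddings : ∀ D : ℕ ⥤ L, (∀ {i j : ℕ} (h : i ⟶ j), IsEmbedding (D.map h)) →
    Limits.HasColimit D
  /-- `C` has all `ω`-colimits over pre-embeddings -/
  colimits_preEmbeddings : ∀ D : ℕ ⥤ C,
    (∀ {i j : ℕ} (h : i ⟶ j), IsPreEmbedding F (D.map h)) → Limits.HasColimit D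
  /-- the product functor `C × C ⥤ C` preserves `ω`-colimits over pre-embeddings -/
  prod_preserves : ∀ D : ℕ ⥤ C × C,
    (∀ {i j : ℕ} (h : i ⟶ j), IsPreEmbedding F (D.map h).1 ∧ IsPreEmbedding F (D.map h).2) →
    Limits.PreservesColimit D (MonoidalCategory.tensor C)

/-- Computationally adequate `CPO`-LNL models. The morphisms `⊥_{A,B}` do not depend on the chosen
e-initial object, which exists in every model. -/
structure IsComputationallyAdequate {F : C ⥤ L} {G : L ⥤ C} [F.LaxBraided] [G.LaxBraided]
    (adj : F ⊣ G) : Prop extends IsCPOLNLModel adj where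
  id_ne_bot : ∀ Z : EInitial L, 𝟙 (𝟙_ L) ≠ Z.botHom (𝟙_ L) (𝟙_ L)
  tensor_reflects : ∀ (Z : EInitial L) {A B : L} (f₁ g₁ : 𝟙_ L ⟶ A) (f₂ g₂ : 𝟙_ L ⟶ B),
    f₁ ≠ Z.botHom _ _ → g₁ ≠ Z.botHom _ _ → f₂ ≠ Z.botHom _ _ → g₂ ≠ Z.botHom _ _ →
    f₁ ⊗ₘ f₂ ≤ g₁ ⊗ₘ g₂ → f₁ ≤ g₁ ∧ f₂ ≤ g₂

end Enriched

/-! ### Lifting of cpos -/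

section Lifting

theorem chain_le {X : Type*} [Preorder X] (c : Chain X) {i j : ℕ} (h : i ≤ j) : c i ≤ c j :=
  c.monotone h

/-- If a chain of `X⊥` leaves `⊥` at index `N`, its tail from `N` on is a chain of `X`. -/
def tailChain {X : Type*} [PartialOrder X] (c : Chain (WithBot X)) (N : ℕ) (hN : c N ≠ ⊥) :
    Chain X where
  toFun k := (c (N + k)).unbot fun hk =>
    hN (le_bot_iff.1 (show c N ≤ ⊥ from (chain_le c (Nat.le_add_right N k)).trans hk.le))
  monotone' _ _ hij := WithBot.unbot_mono _ _ (chain_le c (Nat.add_le_add_left hij N))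

theorem coe_tailChain {X : Type*} [PartialOrder X] (c : Chain (WithBot X)) (N : ℕ) (hN : c N ≠ ⊥)
    (k : ℕ) : ((tailChain c N hN k : X) : WithBot X) = c (N + k) :=
  WithBot.coe_unbot (c (N + k)) _

open Classical in
/-- The supremum of a chain of `X⊥`: it is `⊥` if the chain is constantly `⊥`, and the supremum of
a tail of the chain in `X` otherwise. -/
noncomputable def liftSup {X : Type*} [OmegaCompletePartialOrder X] (c : Chain (WithBot X)) :
    WithBot X :=
  if h : ∃ N, c N ≠ ⊥ then ((ωSup (tailChain c _ (Classical.choose_spec h)) : X) : WithBot X)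
  else ⊥

/-- The lifting `X⊥` of a cpo `X` (a new least element is added) is a cpo. -/
noncomputable instance liftCPO (X : Type*) [OmegaCompletePartialOrder X] :
    OmegaCompletePartialOrder (WithBot X) where
  ωSup := liftSup
  le_ωSup c i := by
    by_cases h : ∃ N, c N ≠ ⊥
    · have h' := Classical.choose_spec h
      rw [liftSup, dif_pos h]
      change c i ≤ _
      refine (chain_le c (Nat.le_add_left i (Classical.choose h))).trans ?_
      rw [← coe_tailChain c _ h', WithBot.coe_le_coe]
      exact le_ωSup _ i
    · push Not at h
      exact (h i).le.trans bot_le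
  ωSup_le c x hx := by
    by_cases h : ∃ N, c N ≠ ⊥
    · have h' := Classical.choose_spec h
      rw [liftSup, dif_pos h]
      have hx0 : x ≠ ⊥ := fun h0 => h' (le_bot_iff.1 ((hx _).trans h0.le))
      rw [← WithBot.le_unbot_iff hx0]
      refine ωSup_le _ _ fun k => ?_
      rw [WithBot.le_unbot_iff, coe_tailChain]
      exact hx _
    · rw [liftSup, dif_neg h]
      exact bot_le

variable {P X B : Type*} [OmegaCompletePartialOrder P] [OmegaCompletePartialOrder X]
  [OmegaCompletePartialOrder B] [OrderBot B]

/-- The strict extension `X⊥ → B` of a function `X → B`. -/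
def liftExt {X : Type*} (f : X → B) (x : WithBot X) : B := WithBot.recBotCoe ⊥ f x

@[simp] theorem liftExt_bot {X : Type*} (f : X → B) : liftExt f ⊥ = ⊥ := rfl

@[simp] theorem liftExt_coe {X : Type*} (f : X → B) (x : X) : liftExt f (x : WithBot X) = f x := rfl

theorem ωSup_lift_eq_bot (c : Chain (WithBot X)) (h : ∀ n, c n = ⊥) : ωSup c = ⊥ :=
  le_bot_iff.1 (ωSup_le _ _ fun n => (h n).le)

theorem ωSup_lift_eq_coe (c : Chain (WithBot X)) (N : ℕ) (hN : c N ≠ ⊥) :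
    ωSup c = ((ωSup (tailChain c N hN) : X) : WithBot X) := by
  apply le_antisymm
  · refine ωSup_le _ _ fun i => (chain_le c (Nat.le_add_left i N)).trans ?_
    rw [← coe_tailChain c N hN, WithBot.coe_le_coe]
    exact le_ωSup _ i
  · have hx0 : ωSup c ≠ ⊥ := fun h0 => hN (le_bot_iff.1 (h0 ▸ le_ωSup c N))
    rw [← WithBot.le_unbot_iff hx0]
    refine ωSup_le _ _ fun k => ?_
    rw [WithBot.le_unbot_iff, coe_tailChain]
    exact le_ωSup _ _

theorem continuous_coe : ωScottContinuous (fun x : X => (x : WithBot X)) := by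
  have hmono : Monotone (fun x : X => (x : WithBot X)) := fun _ _ h => WithBot.coe_le_coe.2 h
  refine .of_monotone_map_ωSup ⟨hmono, fun c => ?_⟩
  rw [ωSup_lift_eq_coe _ 0 WithBot.coe_ne_bot]
  congr 2
  ext k
  refine WithBot.coe_injective ((Eq.trans ?_ (coe_tailChain (c.map ⟨_, hmono⟩) 0 _ k).symm))
  rw [Nat.zero_add]
  rfl

theorem continuous_liftExt₀ {f : P → X → B} (hf : ωScottContinuous (fun q : P × X => f q.1 q.2)) :
    ωScottContinuous (fun q : P × WithBot X => liftExt (f q.1) q.2) := by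
  have hmono : Monotone (fun q : P × WithBot X => liftExt (f q.1) q.2) := by
    rintro ⟨p, x⟩ ⟨p', x'⟩ ⟨h₁, h₂⟩
    induction x using WithBot.recBotCoe with
    | bot => exact bot_le
    | coe x =>
      induction x' using WithBot.recBotCoe with
      | bot => exact absurd (le_bot_iff.1 h₂) WithBot.coe_ne_bot
      | coe x' => exact hf.monotone (show (p, x) ≤ (p', x') from ⟨h₁, WithBot.coe_le_coe.1 h₂⟩)
  refine .of_monotone_map_ωSup ⟨hmono, fun c => le_antisymm ?_ ?_⟩
  · by_cases h : ∃ N, (c N).2 ≠ ⊥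
    · obtain ⟨N, hN⟩ := h
      let d : Chain (P × X) :=
        ⟨⟨fun k => ((c (N + k)).1, tailChain (c.map OrderHom.snd) N hN k), fun i j hij =>
          ⟨(chain_le c (Nat.add_le_add_left hij N)).1, (tailChain _ N hN).monotone hij⟩⟩⟩
      have h1 : (ωSup c).1 ≤ (ωSup d).1 := ωSup_le _ _ fun i =>
        le_trans (chain_le c (Nat.le_add_left i N)).1 (le_ωSup d i).1
      have h2 : (ωSup c).2 = ((ωSup d).2 : WithBot X) := ωSup_lift_eq_coe _ N hN
      have h3 : liftExt (f (ωSup c).1) (ωSup c).2 ≤ f (ωSup d).1 (ωSup d).2 := by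
        rw [h2, liftExt_coe]
        exact hf.monotone (show ((ωSup c).1, (ωSup d).2) ≤ ωSup d from ⟨h1, le_rfl⟩)
      refine h3.trans ((hf.map_ωSup d).le.trans (ωSup_le _ _ fun k => ?_))
      refine le_trans (le_of_eq ?_) (le_ωSup _ (N + k))
      change f (c (N + k)).1 (tailChain (c.map OrderHom.snd) N hN k) = liftExt _ (c (N + k)).2
      have : (c (N + k)).2 = (tailChain (c.map OrderHom.snd) N hN k : WithBot X) :=
        (coe_tailChain (c.map OrderHom.snd) N hN k).symm
      rw [this, liftExt_coe]
      rfl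
    · push Not at h
      have h2 : (ωSup c).2 = ⊥ := ωSup_lift_eq_bot (c.map OrderHom.snd) h
      simp only [h2, liftExt_bot, bot_le]
  · exact ωSup_le _ _ fun k => hmono (le_ωSup c k)

theorem continuous_liftExt {f : P → X → B} (hf : ωScottContinuous (fun q : P × X => f q.1 q.2))
    {g : P → WithBot X} (hg : ωScottContinuous g) :
    ωScottContinuous (fun p => liftExt (f p) (g p)) :=
  (continuous_liftExt₀ hf).comp (Prod.ωScottContinuous.prodMk ωScottContinuous.id hg)

end Lifting

/-! ### Smash products -/

section Smash

variable {P A B C : Type*} [OmegaCompletePartialOrder P]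
  [OmegaCompletePartialOrder A] [OrderBot A] [OmegaCompletePartialOrder B] [OrderBot B]
  [OmegaCompletePartialOrder C] [OrderBot C]

variable (A B) in
/-- The smash product of two pointed cpos: the pairs of elements different from `⊥`, together with
a least element, which is represented by the pair `(⊥, ⊥)`; pairs are ordered componentwise. -/
def Smash : Type _ := {p : A × B // p.1 = ⊥ ↔ p.2 = ⊥}

theorem ωSup_eq_bot_iff (c : Chain A) : ωSup c = ⊥ ↔ ∀ n, c n = ⊥ :=
  ⟨fun h n => le_bot_iff.1 (h ▸ le_ωSup c n), fun h => le_bot_iff.1 (ωSup_le _ _ fun n => (h n).le)⟩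

instance : OmegaCompletePartialOrder (Smash A B) :=
  OmegaCompletePartialOrder.subtype _ fun c hc => by
    rw [Prod.ωSup_fst, Prod.ωSup_snd, ωSup_eq_bot_iff, ωSup_eq_bot_iff]
    exact forall_congr' fun n => hc _ ⟨n, rfl⟩

instance : OrderBot (Smash A B) where
  bot := ⟨(⊥, ⊥), by simp⟩
  bot_le p := show ((⊥, ⊥) : A × B) ≤ p.1 from ⟨bot_le, bot_le⟩

open Classical in
/-- The image `a ⊗ b` of a pair in the smash product. -/
noncomputable def smash (a : A) (b : B) : Smash A B :=
  if h : a ≠ ⊥ ∧ b ≠ ⊥ then ⟨(a, b), by simp [h.1, h.2]⟩ else ⊥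

@[simp] theorem smash_bot_left (b : B) : smash (⊥ : A) b = ⊥ := by simp [smash]

@[simp] theorem smash_bot_right (a : A) : smash a (⊥ : B) = ⊥ := by simp [smash]

theorem smash_val_of_ne {a : A} {b : B} (ha : a ≠ ⊥) (hb : b ≠ ⊥) : (smash a b).1 = (a, b) := by
  simp [smash, ha, hb]

@[simp] theorem bot_val_fst : (⊥ : Smash A B).1.1 = ⊥ := rfl

@[simp] theorem bot_val_snd : (⊥ : Smash A B).1.2 = ⊥ := rfl

@[simp] theorem smash_val (p : Smash A B) : smash p.1.1 p.1.2 = p := by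
  by_cases h : p.1.1 = ⊥
  · have h' := p.2.1 h
    rw [h, smash_bot_left]
    exact Subtype.ext (Prod.ext h.symm h'.symm)
  · exact Subtype.ext (smash_val_of_ne h fun h' => h (p.2.2 h'))

theorem smash_surj (p : Smash A B) : ∃ a b, smash a b = p := ⟨_, _, smash_val p⟩

/-- A function that is strict in both arguments can be evaluated on `a ⊗ b`. -/
theorem apply_smash {Z : Type*} {f : A → B → Z} {z : Z} (h₁ : ∀ b, f ⊥ b = z) (h₂ : ∀ a, f a ⊥ = z)
    (a : A) (b : B) : f (smash a b).1.1 (smash a b).1.2 = f a b := by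
  by_cases ha : a = ⊥
  · subst ha; simp [h₁]
  by_cases hb : b = ⊥
  · subst hb; simp [h₂]
  rw [smash_val_of_ne ha hb]

theorem continuous_fst : ωScottContinuous (fun p : Smash A B => p.1.1) :=
  .of_monotone_map_ωSup ⟨fun _ _ h => h.1, fun _ => rfl⟩

theorem continuous_snd : ωScottContinuous (fun p : Smash A B => p.1.2) :=
  .of_monotone_map_ωSup ⟨fun _ _ h => h.2, fun _ => rfl⟩

theorem continuous_smash₀ : ωScottContinuous (fun q : A × B => smash q.1 q.2) := by
  have hmono : Monotone (fun q : A × B => smash q.1 q.2) := by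
    rintro ⟨a, b⟩ ⟨a', b'⟩ ⟨h₁, h₂⟩
    by_cases ha : a = ⊥
    · subst ha; simp
    by_cases hb : b = ⊥
    · subst hb; simp
    change (smash a b).1 ≤ (smash a' b').1
    rw [smash_val_of_ne ha hb, smash_val_of_ne (fun h => ha (le_bot_iff.1 (h ▸ h₁)))
      (fun h => hb (le_bot_iff.1 (h ▸ h₂)))]
    exact ⟨h₁, h₂⟩
  refine .of_monotone_map_ωSup ⟨hmono, fun c => le_antisymm ?_ ?_⟩
  · by_cases ha : (ωSup c).1 = ⊥
    · simp only [ha, smash_bot_left, bot_le]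
    by_cases hb : (ωSup c).2 = ⊥
    · simp only [hb, smash_bot_right, bot_le]
    have ha' := ha
    have hb' := hb
    rw [Prod.ωSup_fst, ωSup_eq_bot_iff] at ha'
    rw [Prod.ωSup_snd, ωSup_eq_bot_iff] at hb'
    push Not at ha' hb'
    obtain ⟨m, hm⟩ := ha'
    obtain ⟨n, hn⟩ := hb'
    have key : ∀ i, c i ≤ (ωSup (c.map ⟨_, hmono⟩)).1 := fun i => by
      let k := max i (max m n)
      have hk1 : (c k).1 ≠ ⊥ := fun h => hm (le_bot_iff.1
        (show (c m).1 ≤ ⊥ from h ▸ (chain_le c (show m ≤ k by omega)).1))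
      have hk2 : (c k).2 ≠ ⊥ := fun h => hn (le_bot_iff.1
        (show (c n).2 ≤ ⊥ from h ▸ (chain_le c (show n ≤ k by omega)).2))
      refine (chain_le c (show i ≤ k by omega)).trans ?_
      have := le_ωSup (c.map ⟨_, hmono⟩) k
      exact (smash_val_of_ne hk1 hk2).symm.le.trans this
    change (smash (ωSup c).1 (ωSup c).2).1 ≤ _
    rw [smash_val_of_ne ha hb]
    exact ωSup_le c _ key
  · exact ωSup_le _ _ fun k => hmono (le_ωSup c k)

theorem continuous_smash {f : P → A} {g : P → B} (hf : ωScottContinuous f)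
    (hg : ωScottContinuous g) : ωScottContinuous (fun p => smash (f p) (g p)) :=
  continuous_smash₀.comp (Prod.ωScottContinuous.prodMk hf hg)

end Smash

/-! ### The category of pointed cpos and strict Scott-continuous functions -/

section StrictHom

variable {A B C : Type*} [OmegaCompletePartialOrder A] [OrderBot A] [OmegaCompletePartialOrder B]
  [OrderBot B] [OmegaCompletePartialOrder C] [OrderBot C]

variable (A B) in
/-- Strict Scott-continuous functions between pointed cpos. -/
def StrictHom : Type _ := {f : A →𝒄 B // f ⊥ = ⊥}

instance : FunLike (StrictHom A B) A B where
  coe f := f.1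
  coe_injective _ _ h := Subtype.ext (DFunLike.coe_injective h)

@[ext] theorem StrictHom.ext {f g : StrictHom A B} (h : ∀ a, f a = g a) : f = g :=
  DFunLike.ext _ _ h

/-- Build a strict Scott-continuous function. -/
def StrictHom.mk (f : A → B) (hc : ωScottContinuous f) (hb : f ⊥ = ⊥) : StrictHom A B :=
  ⟨.ofFun f hc, hb⟩

@[simp] theorem StrictHom.mk_apply (f : A → B) (hc : ωScottContinuous f) (hb : f ⊥ = ⊥) (a : A) :
    StrictHom.mk f hc hb a = f a := rfl

@[simp] theorem StrictHom.map_bot (f : StrictHom A B) : f ⊥ = ⊥ := f.2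

theorem StrictHom.continuous (f : StrictHom A B) : ωScottContinuous f := f.1.ωScottContinuous

/-- The strict function space: strict Scott-continuous functions with the pointwise order. -/
instance : OmegaCompletePartialOrder (StrictHom A B) :=
  OmegaCompletePartialOrder.subtype _ fun _ hc =>
    le_bot_iff.1 (ωSup_le _ _ fun n => (hc _ ⟨n, rfl⟩).le)

instance : OrderBot (StrictHom A B) where
  bot := ⟨ContinuousHom.const ⊥, rfl⟩
  bot_le _ := fun _ => bot_le

@[simp] theorem StrictHom.bot_apply (a : A) : (⊥ : StrictHom A B) a = ⊥ := rfl

theorem StrictHom.continuous_of_apply {P : Type*} [OmegaCompletePartialOrder P]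
    {f : P → StrictHom A B} (h : ∀ a, ωScottContinuous fun p => f p a) : ωScottContinuous f :=
  .of_monotone_map_ωSup ⟨fun _ _ hp a => (h a).monotone hp,
    fun c => StrictHom.ext fun a => (h a).map_ωSup c⟩

theorem StrictHom.continuous_eval {P : Type*} [OmegaCompletePartialOrder P]
    {f : P → StrictHom A B} (hf : ωScottContinuous f) {g : P → A} (hg : ωScottContinuous g) :
    ωScottContinuous fun p => f p (g p) := by
  have hval : ωScottContinuous (fun h : StrictHom A B => h.1) :=
    .of_monotone_map_ωSup ⟨fun _ _ h => h, fun _ => rfl⟩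
  exact ContinuousHom.ωScottContinuous_apply (hval.comp hf) hg

end StrictHom

/-- The objects of `CPO⊥!`: pointed cpos. -/
structure PointedCPO : Type (u + 1) where
  /-- Bundle a pointed cpo. -/
  of ::
  /-- The underlying type. -/
  carrier : Type u
  [cpo : OmegaCompletePartialOrder carrier]
  [orderBot : OrderBot carrier]

attribute [instance] PointedCPO.cpo PointedCPO.orderBot

namespace PointedCPO

instance : CoeSort PointedCPO.{u} (Type u) := ⟨carrier⟩

/-- The category `CPO⊥!` of pointed cpos and strict Scott-continuous functions. -/
instance : LargeCategory.{u} PointedCPO.{u} where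
  Hom X Y := StrictHom X Y
  id X := .mk (fun x => x) .id rfl
  comp f g := .mk (fun x => g (f x)) (g.continuous.comp f.continuous) (by simp)

instance : ConcreteCategory PointedCPO.{u} (fun X Y => StrictHom X Y) where
  hom f := f
  ofHom f := f

/-- Build a morphism of `CPO⊥!`. -/
def homMk {X Y : PointedCPO.{u}} (f : X → Y) (hc : ωScottContinuous f) (hb : f ⊥ = ⊥) : X ⟶ Y :=
  StrictHom.mk f hc hb

variable {X Y Z : PointedCPO.{u}}

@[simp] theorem homMk_apply (f : X → Y) (hc : ωScottContinuous f) (hb : f ⊥ = ⊥) (x : X) :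
    homMk f hc hb x = f x := rfl

@[simp] theorem map_bot (f : X ⟶ Y) : f ⊥ = ⊥ := StrictHom.map_bot _

theorem continuous (f : X ⟶ Y) : ωScottContinuous f := StrictHom.continuous _

theorem hom_ext {f g : X ⟶ Y} (h : ∀ x, f x = g x) : f = g := StrictHom.ext h

/-- A morphism out of a smash product is determined by its values at the elements `a ⊗ b`. -/
theorem hom_ext_smash {f g : of (Smash X Y) ⟶ Z}
    (h : ∀ (x : X) (y : Y), f (smash x y) = g (smash x y)) :
    f = g :=
  hom_ext fun p => by simpa using h p.1.1 p.1.2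

/-- The action of the smash product on morphisms, `(f ⊗ g) (x ⊗ y) = f x ⊗ g y`. -/
noncomputable def smashMap {X X' Y Y' : PointedCPO.{u}} (f : X ⟶ X') (g : Y ⟶ Y') :
    of (Smash X Y) ⟶ of (Smash X' Y') :=
  homMk (fun p => smash (f p.1.1) (g p.1.2))
    (continuous_smash ((continuous f).comp continuous_fst) ((continuous g).comp continuous_snd))
    (by simp)

@[simp] theorem smashMap_smash {X X' Y Y' : PointedCPO.{u}} (f : X ⟶ X') (g : Y ⟶ Y') (x : X)
    (y : Y) : smashMap f g (smash x y) = smash (f x) (g y) :=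
  apply_smash (f := fun x y => smash (f x) (g y)) (z := ⊥) (by simp) (by simp) x y

/-- The map `(x ⊗ y) ⊗ z ↦ x ⊗ (y ⊗ z)`. -/
noncomputable def smashAssocHom (X Y Z : PointedCPO.{u}) :
    of (Smash (Smash X Y) Z) ⟶ of (Smash X (Smash Y Z)) :=
  homMk (fun p => smash p.1.1.1.1 (smash p.1.1.1.2 p.1.2))
    (continuous_smash (continuous_fst.comp continuous_fst)
      (continuous_smash (continuous_snd.comp continuous_fst) continuous_snd))
    (by simp)

@[simp] theorem smashAssocHom_smash {X Y Z : PointedCPO.{u}} (x : X) (y : Y) (z : Z) :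
    smashAssocHom X Y Z (smash (smash x y) z) = smash x (smash y z) :=
  (apply_smash (f := fun (p : Smash X Y) (z : Z) => smash p.1.1 (smash p.1.2 z))
    (z := ⊥) (by simp) (by simp) _ z).trans
    (apply_smash (f := fun (x : X) (y : Y) => smash x (smash y z)) (z := ⊥) (by simp) (by simp) x y)

/-- The map `x ⊗ (y ⊗ z) ↦ (x ⊗ y) ⊗ z`. -/
noncomputable def smashAssocInv (X Y Z : PointedCPO.{u}) :
    of (Smash X (Smash Y Z)) ⟶ of (Smash (Smash X Y) Z) :=
  homMk (fun p => smash (smash p.1.1 p.1.2.1.1) p.1.2.1.2)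
    (continuous_smash (continuous_smash continuous_fst (continuous_fst.comp continuous_snd))
      (continuous_snd.comp continuous_snd))
    (by simp)

@[simp] theorem smashAssocInv_smash {X Y Z : PointedCPO.{u}} (x : X) (y : Y) (z : Z) :
    smashAssocInv X Y Z (smash x (smash y z)) = smash (smash x y) z :=
  (apply_smash (f := fun (x : X) (p : Smash Y Z) => smash (smash x p.1.1) p.1.2)
    (z := ⊥) (by simp) (by simp) x _).trans
    (apply_smash (f := fun (y : Y) (z : Z) => smash (smash x y) z) (z := ⊥) (by simp) (by simp) y z)

/-- The tensor unit: the two-element cpo, which is the lifting of the one-element cpo. -/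
noncomputable def unit : PointedCPO.{u} := of (WithBot PUnit.{u + 1})

/-- The non-bottom element of the tensor unit. -/
def top : unit.{u} := ((PUnit.unit : PUnit.{u + 1}) : WithBot PUnit.{u + 1})

theorem unit_cases (i : unit.{u}) : i = ⊥ ∨ i = top := by
  induction i using WithBot.recBotCoe with
  | bot => exact .inl rfl
  | coe i => exact .inr rfl

theorem top_ne_bot : (top : unit.{u}) ≠ ⊥ := WithBot.coe_ne_bot

/-- The left unitor `⊤ ⊗ x ↦ x`. -/
noncomputable def smashLeftUnitor (X : PointedCPO.{u}) : of (Smash unit.{u} X) ≅ X where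
  hom := homMk (fun p => p.1.2) continuous_snd rfl
  inv := homMk (fun x => smash top x) (continuous_smash .const .id) (by simp)
  hom_inv_id := hom_ext fun p => by
    obtain ⟨⟨i, x⟩, h⟩ := p
    rcases unit_cases i with rfl | rfl
    · obtain rfl : x = ⊥ := h.1 rfl
      exact smash_bot_right _
    · exact smash_val (⟨(top, x), h⟩ : Smash unit.{u} X)
  inv_hom_id := hom_ext fun x => by
    by_cases hx : x = ⊥
    · subst hx; simp
    · exact congrArg Prod.snd (smash_val_of_ne top_ne_bot hx)

@[simp] theorem smashLeftUnitor_hom_smash {X : PointedCPO.{u}} (x : X) :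
    (smashLeftUnitor X).hom (smash top x) = x :=
  DFunLike.congr_fun (F := StrictHom X X) (smashLeftUnitor X).inv_hom_id x

/-- The right unitor `x ⊗ ⊤ ↦ x`. -/
noncomputable def smashRightUnitor (X : PointedCPO.{u}) : of (Smash X unit.{u}) ≅ X where
  hom := homMk (fun p => p.1.1) continuous_fst rfl
  inv := homMk (fun x => smash x top) (continuous_smash .id .const) (by simp)
  hom_inv_id := hom_ext fun p => by
    obtain ⟨⟨x, i⟩, h⟩ := p
    rcases unit_cases i with rfl | rfl
    · obtain rfl : x = ⊥ := h.2 rfl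
      exact smash_bot_left _
    · exact smash_val (⟨(x, top), h⟩ : Smash X unit.{u})
  inv_hom_id := hom_ext fun x => by
    by_cases hx : x = ⊥
    · subst hx; simp
    · exact congrArg Prod.fst (smash_val_of_ne hx top_ne_bot)

@[simp] theorem smashRightUnitor_hom_smash {X : PointedCPO.{u}} (x : X) :
    (smashRightUnitor X).hom (smash x top) = x :=
  DFunLike.congr_fun (F := StrictHom X X) (smashRightUnitor X).inv_hom_id x

/-- The associator `(x ⊗ y) ⊗ z ↦ x ⊗ (y ⊗ z)`. -/
noncomputable def smashAssoc (X Y Z : PointedCPO.{u}) :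
    of (Smash (Smash X Y) Z) ≅ of (Smash X (Smash Y Z)) where
  hom := smashAssocHom X Y Z
  inv := smashAssocInv X Y Z
  hom_inv_id := hom_ext fun q => by
    obtain ⟨p, z, rfl⟩ := smash_surj (A := Smash X Y) (B := Z) q
    obtain ⟨x, y, rfl⟩ := smash_surj p
    exact (congrArg (smashAssocInv X Y Z) (smashAssocHom_smash x y z)).trans
      (smashAssocInv_smash x y z)
  inv_hom_id := hom_ext fun q => by
    obtain ⟨x, p, rfl⟩ := smash_surj (A := X) (B := Smash Y Z) q
    obtain ⟨y, z, rfl⟩ := smash_surj p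
    exact (congrArg (smashAssocHom X Y Z) (smashAssocInv_smash x y z)).trans
      (smashAssocHom_smash x y z)

/-- The map `x ⊗ y ↦ y ⊗ x`. -/
noncomputable def smashSwap (X Y : PointedCPO.{u}) : of (Smash X Y) ⟶ of (Smash Y X) :=
  homMk (fun p => smash p.1.2 p.1.1) (continuous_smash continuous_snd continuous_fst) (by simp)

theorem smashSwap_smash {X Y : PointedCPO.{u}} (x : X) (y : Y) :
    smashSwap X Y (smash x y) = smash y x :=
  apply_smash (f := fun (x : X) (y : Y) => smash y x) (z := ⊥) (by simp) (by simp) x y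

/-- The data of the monoidal structure on `CPO⊥!` given by the smash product. -/
noncomputable instance : MonoidalCategoryStruct PointedCPO.{u} where
  tensorObj X Y := of (Smash X Y)
  tensorUnit := unit
  tensorHom := smashMap
  whiskerLeft X _ _ g := smashMap (𝟙 X) g
  whiskerRight f Y := smashMap f (𝟙 Y)
  associator := smashAssoc
  leftUnitor := smashLeftUnitor
  rightUnitor := smashRightUnitor

/-- The element `x ⊗ y` of the tensor product. -/
noncomputable def tmul {X Y : PointedCPO.{u}} (x : X) (y : Y) : (X ⊗ Y : PointedCPO.{u}) :=
  smash x y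

/-- The non-bottom element of the tensor unit. -/
noncomputable def one : (𝟙_ PointedCPO.{u} : PointedCPO.{u}) := top

theorem tmul_surj {X Y : PointedCPO.{u}} (p : (X ⊗ Y : PointedCPO.{u})) :
    ∃ (x : X) (y : Y), tmul x y = p := smash_surj (A := X) (B := Y) p

theorem one_cases (i : (𝟙_ PointedCPO.{u} : PointedCPO.{u})) : i = ⊥ ∨ i = one := unit_cases i

@[simp] theorem tmul_bot_left {X Y : PointedCPO.{u}} (y : Y) : tmul (⊥ : X) y = ⊥ :=
  smash_bot_left y

@[simp] theorem tmul_bot_right {X Y : PointedCPO.{u}} (x : X) : tmul x (⊥ : Y) = ⊥ :=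
  smash_bot_right x

@[simp] theorem tensorHom_tmul {X X' Y Y' : PointedCPO.{u}} (f : X ⟶ X') (g : Y ⟶ Y') (x : X)
    (y : Y) : (f ⊗ₘ g) (tmul x y) = tmul (f x) (g y) := smashMap_smash f g x y

@[simp] theorem whiskerLeft_tmul {X Y Y' : PointedCPO.{u}} (g : Y ⟶ Y') (x : X)
    (y : Y) : (X ◁ g) (tmul x y) = tmul x (g y) := smashMap_smash _ g x y

@[simp] theorem whiskerRight_tmul {X X' Y : PointedCPO.{u}} (f : X ⟶ X') (x : X)
    (y : Y) : (f ▷ Y) (tmul x y) = tmul (f x) y := smashMap_smash f _ x y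

@[simp] theorem associator_hom_tmul {X Y Z : PointedCPO.{u}} (x : X) (y : Y) (z : Z) :
    (α_ X Y Z).hom (tmul (tmul x y) z) = tmul x (tmul y z) := smashAssocHom_smash x y z

@[simp] theorem associator_inv_tmul {X Y Z : PointedCPO.{u}} (x : X) (y : Y) (z : Z) :
    (α_ X Y Z).inv (tmul x (tmul y z)) = tmul (tmul x y) z := smashAssocInv_smash x y z

@[simp] theorem leftUnitor_tmul {X : PointedCPO.{u}} (x : X) :
    (λ_ X).hom (tmul one x) = x := smashLeftUnitor_hom_smash x

@[simp] theorem rightUnitor_tmul {X : PointedCPO.{u}} (x : X) :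
    (ρ_ X).hom (tmul x one) = x := smashRightUnitor_hom_smash x

/-- A morphism out of a tensor product is determined by its values at the elements `x ⊗ y`. -/
theorem hom_ext_tmul {X Y Z : PointedCPO.{u}} {f g : X ⊗ Y ⟶ Z}
    (h : ∀ (x : X) (y : Y), f (tmul x y) = g (tmul x y)) : f = g :=
  hom_ext fun p => by
    obtain ⟨x, y, rfl⟩ := tmul_surj p
    exact h x y

/-- The smash product makes `CPO⊥!` a monoidal category. -/
noncomputable instance : MonoidalCategory PointedCPO.{u} :=
  MonoidalCategory.ofTensorHom
    (id_tensorHom_id := fun _ _ => hom_ext_tmul fun x y => by simp)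
    (id_tensorHom := fun _ _ _ _ => rfl)
    (tensorHom_id := fun _ _ => rfl)
    (tensorHom_comp_tensorHom := fun f₁ f₂ g₁ g₂ => hom_ext_tmul fun x y => by simp)
    (associator_naturality := fun f₁ f₂ f₃ => hom_ext_tmul fun p z => by
      obtain ⟨x, y, rfl⟩ := tmul_surj p
      simp)
    (leftUnitor_naturality := fun f => hom_ext_tmul fun i x => by
      rcases one_cases i with rfl | rfl <;> simp)
    (rightUnitor_naturality := fun f => hom_ext_tmul fun x i => by
      rcases one_cases i with rfl | rfl <;> simp)
    (pentagon := fun _ _ _ _ => hom_ext_tmul fun q z => by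
      obtain ⟨p, y, rfl⟩ := tmul_surj q
      obtain ⟨w, x, rfl⟩ := tmul_surj p
      simp)
    (triangle := fun _ _ => hom_ext_tmul fun p y => by
      obtain ⟨x, i, rfl⟩ := tmul_surj p
      rcases one_cases i with rfl | rfl <;> simp)

/-- The symmetry `x ⊗ y ↦ y ⊗ x`. -/
noncomputable def tensorSwap (X Y : PointedCPO.{u}) : X ⊗ Y ⟶ Y ⊗ X := smashSwap X Y

@[simp] theorem tensorSwap_tmul {X Y : PointedCPO.{u}} (x : X) (y : Y) :
    tensorSwap X Y (tmul x y) = tmul y x := smashSwap_smash x y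

/-- `CPO⊥!` with the smash product is a symmetric monoidal category. -/
noncomputable instance : SymmetricCategory PointedCPO.{u} where
  braiding X Y :=
    { hom := tensorSwap X Y
      inv := tensorSwap Y X
      hom_inv_id := hom_ext_tmul fun x y => by simp
      inv_hom_id := hom_ext_tmul fun x y => by simp }
  braiding_naturality_right _ _ _ _ := hom_ext_tmul fun x y => by simp
  braiding_naturality_left _ _ := hom_ext_tmul fun x y => by simp
  hexagon_forward _ _ _ := hom_ext_tmul fun p z => by
    obtain ⟨x, y, rfl⟩ := tmul_surj p
    simp
  hexagon_reverse _ _ _ := hom_ext_tmul fun x p => by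
    obtain ⟨y, z, rfl⟩ := tmul_surj p
    simp
  symmetry _ _ := hom_ext_tmul fun x y => by simp

@[simp] theorem braiding_tmul {X Y : PointedCPO.{u}} (x : X) (y : Y) :
    (β_ X Y).hom (tmul x y) = tmul y x := tensorSwap_tmul x y

/-- The functor `X ⊸ -`, where `X ⊸ Y` is the strict function space. -/
def strictFun (X : PointedCPO.{u}) : PointedCPO.{u} ⥤ PointedCPO.{u} where
  obj Y := of (StrictHom X Y)
  map {Y Z} f := homMk
    (fun h : StrictHom X Y => (StrictHom.mk (fun x => f (h x))
      ((continuous f).comp h.continuous) (by simp) : StrictHom X Z))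
    (StrictHom.continuous_of_apply fun x =>
      (continuous f).comp (StrictHom.continuous_eval .id .const))
    (StrictHom.ext fun _ => map_bot f)

/-- Evaluation of an element of the strict function space. -/
def app {X Y : PointedCPO.{u}} (h : (strictFun X).obj Y) (x : X) : Y :=
  (show StrictHom X Y from h) x

theorem app_bot_left {X Y : PointedCPO.{u}} (x : X) : app (⊥ : (strictFun X).obj Y) x = ⊥ := rfl

theorem app_bot_right {X Y : PointedCPO.{u}} (h : (strictFun X).obj Y) : app h ⊥ = ⊥ :=
  StrictHom.map_bot (show StrictHom X Y from h)

/-- Currying: strict maps `X ⊗ Y → Z` correspond to strict maps `Y → (X ⊸ Z)`. -/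
noncomputable def curryEquiv (X Y Z : PointedCPO.{u}) :
    (X ⊗ Y ⟶ Z) ≃ (Y ⟶ (strictFun X).obj Z) where
  toFun f := homMk
    (fun y => (StrictHom.mk (fun x => f (tmul x y))
      ((continuous f).comp (continuous_smash .id .const)) (by simp) : StrictHom X Z))
    (StrictHom.continuous_of_apply fun x => (continuous f).comp (continuous_smash .const .id))
    (StrictHom.ext fun x => by
      rw [StrictHom.mk_apply, tmul_bot_right, map_bot]; rfl)
  invFun g := homMk
    (fun p : Smash X Y => app (g p.1.2) p.1.1)
    (StrictHom.continuous_eval ((continuous g).comp continuous_snd) continuous_fst)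
    (app_bot_right _)
  left_inv f := hom_ext_tmul fun x y => by
    exact apply_smash (f := fun (x : X) (y : Y) => f (tmul x y)) (z := ⊥) (by simp) (by simp) x y
  right_inv g := hom_ext fun y => StrictHom.ext fun x => by
    exact apply_smash (f := fun (x : X) (y : Y) => app (g y) x) (z := ⊥)
      (fun _ => app_bot_right _) (fun x => by rw [map_bot]; rfl) x y

theorem curryEquiv_symm_tmul {X Y Z : PointedCPO.{u}} (g : Y ⟶ (strictFun X).obj Z) (x : X)
    (y : Y) : (curryEquiv X Y Z).symm g (tmul x y) = app (g y) x :=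
  apply_smash (f := fun (x : X) (y : Y) => app (g y) x) (z := ⊥)
    (fun _ => app_bot_right _) (fun x => by rw [map_bot]; rfl) x y

/-- `CPO⊥!` is monoidal closed, with the strict function space as internal hom. -/
noncomputable instance : MonoidalClosed PointedCPO.{u} where
  closed X :=
    { rightAdj := strictFun X
      adj := Adjunction.mkOfHomEquiv
        { homEquiv := fun Y Z => curryEquiv X Y Z
          homEquiv_naturality_left_symm := fun f g => hom_ext_tmul fun x y => by
            refine (curryEquiv_symm_tmul (f ≫ g) x y).trans ?_
            change _ = (curryEquiv X _ _).symm g ((X ◁ f) (tmul x y))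
            rw [whiskerLeft_tmul, curryEquiv_symm_tmul]
            rfl
          homEquiv_naturality_right := fun f g => rfl } }

end PointedCPO

/-! ### The cartesian monoidal category of cpos -/

namespace WCPO

/-- Build a morphism of `CPO`. -/
def homMk {X Y : ωCPO.{u}} (f : X → Y) (hf : ωScottContinuous f) : X ⟶ Y :=
  ContinuousHom.ofFun f hf

theorem hom_ext {X Y : ωCPO.{u}} {f g : X ⟶ Y} (h : ∀ x, f x = g x) : f = g :=
  ContinuousHom.ext _ _ h

theorem continuous {X Y : ωCPO.{u}} (f : X ⟶ Y) : ωScottContinuous f :=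
  ContinuousHom.ωScottContinuous f

/-- Cartesian products of cpos, with the componentwise order, as a monoidal structure on `CPO`. -/
instance : MonoidalCategory ωCPO.{u} where
  tensorObj X Y := ωCPO.of (X × Y)
  tensorUnit := ωCPO.of PUnit.{u + 1}
  tensorHom f g := homMk (fun p => (f p.1, g p.2))
    (Prod.ωScottContinuous.prodMk ((continuous f).comp Prod.ωScottContinuous_fst)
      ((continuous g).comp Prod.ωScottContinuous_snd))
  whiskerLeft X _ _ g := homMk (fun p => (p.1, g p.2))
    (Prod.ωScottContinuous.prodMk Prod.ωScottContinuous_fst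
      ((continuous g).comp Prod.ωScottContinuous_snd))
  whiskerRight f Y := homMk (fun p => (f p.1, p.2))
    (Prod.ωScottContinuous.prodMk ((continuous f).comp Prod.ωScottContinuous_fst)
      Prod.ωScottContinuous_snd)
  associator X Y Z :=
    { hom := homMk (fun p => (p.1.1, (p.1.2, p.2))) (.of_monotone_map_ωSup
        ⟨fun _ _ h => ⟨h.1.1, h.1.2, h.2⟩, fun _ => rfl⟩)
      inv := homMk (fun p => ((p.1, p.2.1), p.2.2)) (.of_monotone_map_ωSup
        ⟨fun _ _ h => ⟨⟨h.1, h.2.1⟩, h.2.2⟩, fun _ => rfl⟩) }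
  leftUnitor X :=
    { hom := homMk (fun p => p.2) Prod.ωScottContinuous_snd
      inv := homMk (fun x => (PUnit.unit, x)) (Prod.ωScottContinuous.prodMk .const .id) }
  rightUnitor X :=
    { hom := homMk (fun p => p.1) Prod.ωScottContinuous_fst
      inv := homMk (fun x => (x, PUnit.unit)) (Prod.ωScottContinuous.prodMk .id .const) }

/-- Cartesian products of cpos are categorical products. -/
instance : CartesianMonoidalCategory ωCPO.{u} where
  isTerminalTensorUnit := Limits.IsTerminal.ofUniqueHom
    (fun _ => homMk (fun _ => PUnit.unit) .const) (fun _ _ => hom_ext fun _ => rfl)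
  fst _ _ := homMk (fun p => p.1) Prod.ωScottContinuous_fst
  snd _ _ := homMk (fun p => p.2) Prod.ωScottContinuous_snd
  tensorProductIsBinaryProduct _ _ := Limits.BinaryFan.isLimitMk
    (fun s => homMk (fun z => (s.fst z, s.snd z))
      (Prod.ωScottContinuous.prodMk (continuous s.fst) (continuous s.snd)))
    (fun _ => rfl) (fun _ => rfl)
    (fun _ _ h₁ h₂ => hom_ext fun z =>
      Prod.ext (congrArg (fun k => k z) h₁) (congrArg (fun k => k z) h₂))
  fst_def _ _ := rfl
  snd_def _ _ := rfl

instance : BraidedCategory ωCPO.{u} := .ofCartesianMonoidalCategory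

end WCPO


/-! ### Lifting, the forgetful functor, and their adjunction -/

/-- The lifting functor `CPO ⥤ CPO⊥!`. -/
noncomputable def liftFunctor : ωCPO.{u} ⥤ PointedCPO.{u} where
  obj X := .of (WithBot X)
  map {X Y} f := PointedCPO.homMk (liftExt fun x : X => ((f x : Y) : WithBot Y))
    (continuous_liftExt (f := fun (_ : WithBot X) (x : X) => ((f x : Y) : WithBot Y))
      (continuous_coe.comp ((WCPO.continuous f).comp Prod.ωScottContinuous_snd)) .id) rfl
  map_id X := PointedCPO.hom_ext fun x => by
    induction x using WithBot.recBotCoe <;> rfl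
  map_comp f g := PointedCPO.hom_ext fun x => by
    induction x using WithBot.recBotCoe <;> rfl

/-- The forgetful functor `CPO⊥! ⥤ CPO`. -/
def forgetFunctor : PointedCPO.{u} ⥤ ωCPO.{u} where
  obj A := .of A
  map f := WCPO.homMk (fun x => f x) (PointedCPO.continuous f)

/-- Strict maps `X⊥ → A` correspond to Scott-continuous maps `X → A`, by restriction to `X`. -/
noncomputable def liftHomEquiv (X : ωCPO.{u}) (A : PointedCPO.{u}) :
    (liftFunctor.obj X ⟶ A) ≃ (X ⟶ forgetFunctor.obj A) where
  toFun f := WCPO.homMk (fun x : X => f (x : WithBot X))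
    ((PointedCPO.continuous f).comp continuous_coe)
  invFun (g : X →𝒄 A) := PointedCPO.homMk (liftExt fun x : X => g x)
    (continuous_liftExt (f := fun (_ : WithBot X) (x : X) => g x)
      (g.ωScottContinuous.comp Prod.ωScottContinuous_snd) .id) rfl
  left_inv f := PointedCPO.hom_ext fun x => by
    induction x using WithBot.recBotCoe with
    | bot => exact (PointedCPO.map_bot f).symm
    | coe x => rfl
  right_inv _ := rfl

/-- Lifting is left adjoint to the forgetful functor. -/
noncomputable def liftForgetAdjunction : liftFunctor.{u} ⊣ forgetFunctor.{u} :=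
  Adjunction.mkOfHomEquiv
    { homEquiv := liftHomEquiv
      homEquiv_naturality_left_symm := fun f g => PointedCPO.hom_ext fun x => by
        induction x using WithBot.recBotCoe <;> rfl
      homEquiv_naturality_right := fun _ _ => rfl }

/-- The map `X⊥ ⊗ Y⊥ → (X × Y)⊥`, `x ⊗ y ↦ (x, y)`. -/
noncomputable def liftMu (X Y : ωCPO.{u}) :
    liftFunctor.obj X ⊗ liftFunctor.obj Y ⟶ liftFunctor.obj (X ⊗ Y) :=
  PointedCPO.homMk
    (fun p : Smash (WithBot X) (WithBot Y) => (liftExt (fun x : X =>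
      liftExt (fun y : Y => (((x, y) : X × Y) : WithBot (X × Y))) p.1.2) p.1.1 : WithBot (X × Y)))
    (continuous_liftExt (P := Smash (WithBot X) (WithBot Y))
      (f := fun p (x : X) => liftExt (fun y : Y => (((x, y) : X × Y) : WithBot (X × Y))) p.1.2)
      (continuous_liftExt (P := Smash (WithBot X) (WithBot Y) × X)
        (f := fun q (y : Y) => (((q.2, y) : X × Y) : WithBot (X × Y)))
        (continuous_coe.comp (Prod.ωScottContinuous.prodMk
          (Prod.ωScottContinuous_snd.comp Prod.ωScottContinuous_fst) Prod.ωScottContinuous_snd))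
        (continuous_snd.comp Prod.ωScottContinuous_fst))
      continuous_fst)
    rfl

/-- The inclusion `X → X⊥`. -/
def up {X : ωCPO.{u}} (x : X) : liftFunctor.obj X := (x : WithBot X)

theorem up_cases {X : ωCPO.{u}} (x : liftFunctor.obj X) : x = ⊥ ∨ ∃ a : X, x = up a := by
  induction x using WithBot.recBotCoe with
  | bot => exact .inl rfl
  | coe a => exact .inr ⟨a, rfl⟩

theorem up_ne_bot {X : ωCPO.{u}} (x : X) : up x ≠ ⊥ := WithBot.coe_ne_bot

@[simp] theorem liftFunctor_map_up {X Y : ωCPO.{u}} (f : X ⟶ Y) (x : X) :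
    liftFunctor.map f (up x) = up (f x) := rfl

@[simp] theorem liftMu_tmul_up {X Y : ωCPO.{u}} (x : X) (y : Y) :
    liftMu X Y (PointedCPO.tmul (up x) (up y)) = up (X := X ⊗ Y) ((x, y) : X × Y) := by
  exact apply_smash (A := WithBot X) (B := WithBot Y)
    (f := fun a b => (liftExt (fun x : X => liftExt (fun y : Y =>
      (((x, y) : X × Y) : WithBot (X × Y))) b) a : WithBot (X × Y)))
    (z := ⊥) (fun _ => rfl) (fun a => by induction a using WithBot.recBotCoe <;> rfl) x y

/-- The identification of the tensor unit with the lifting of the one-element cpo. -/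
noncomputable def liftEps : 𝟙_ PointedCPO.{u} ⟶ liftFunctor.obj (𝟙_ ωCPO.{u}) :=
  PointedCPO.homMk (fun i => i) .id rfl

@[simp] theorem liftEps_one :
    liftEps PointedCPO.one.{u} = up (X := 𝟙_ ωCPO.{u}) (PUnit.unit : PUnit.{u + 1}) := rfl

/-- Lifting is a symmetric monoidal functor, with structure maps `x ⊗ y ↦ (x, y)` and `⊤ ↦ ()`. -/
noncomputable instance : liftFunctor.{u}.LaxBraided where
  ε := liftEps
  μ := liftMu
  μ_natural_left f Y := PointedCPO.hom_ext_tmul fun x y => by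
    obtain rfl | ⟨x, rfl⟩ := up_cases x <;> obtain rfl | ⟨y, rfl⟩ := up_cases y <;> simp
    rfl
  μ_natural_right X g := PointedCPO.hom_ext_tmul fun x y => by
    obtain rfl | ⟨x, rfl⟩ := up_cases x <;> obtain rfl | ⟨y, rfl⟩ := up_cases y <;> simp
    rfl
  associativity X Y Z := PointedCPO.hom_ext_tmul fun p z => by
    obtain ⟨x, y, rfl⟩ := PointedCPO.tmul_surj p
    obtain rfl | ⟨x, rfl⟩ := up_cases x <;> obtain rfl | ⟨y, rfl⟩ := up_cases y <;>
      obtain rfl | ⟨z, rfl⟩ := up_cases z <;> simp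
    rfl
  left_unitality X := PointedCPO.hom_ext_tmul fun i x => by
    obtain rfl | rfl := PointedCPO.one_cases i <;> obtain rfl | ⟨x, rfl⟩ := up_cases x <;> simp
    rfl
  right_unitality X := PointedCPO.hom_ext_tmul fun x i => by
    obtain rfl | rfl := PointedCPO.one_cases i <;> obtain rfl | ⟨x, rfl⟩ := up_cases x <;> simp
    rfl
  braided X Y := PointedCPO.hom_ext_tmul fun x y => by
    obtain rfl | ⟨x, rfl⟩ := up_cases x <;> obtain rfl | ⟨y, rfl⟩ := up_cases y <;> simp
    rfl

/-- The forgetful functor is a symmetric monoidal functor, with structure maps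
`(a, b) ↦ a ⊗ b` and `() ↦ ⊤`. -/
noncomputable instance : forgetFunctor.{u}.LaxBraided where
  ε := WCPO.homMk (fun _ => PointedCPO.one) .const
  μ A B := WCPO.homMk (fun p : A × B => PointedCPO.tmul p.1 p.2) continuous_smash₀
  μ_natural_left {A _} f B := WCPO.hom_ext fun (p : A × B) =>
    (PointedCPO.whiskerRight_tmul f p.1 p.2).symm
  μ_natural_right {B _} A g := WCPO.hom_ext fun (p : A × B) =>
    (PointedCPO.whiskerLeft_tmul g p.1 p.2).symm
  associativity A B C := WCPO.hom_ext fun (p : (A × B) × C) =>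
    PointedCPO.associator_hom_tmul p.1.1 p.1.2 p.2
  left_unitality A := WCPO.hom_ext fun (p : PUnit × A) => (PointedCPO.leftUnitor_tmul p.2).symm
  right_unitality A := WCPO.hom_ext fun (p : A × PUnit) => (PointedCPO.rightUnitor_tmul p.1).symm
  braided A B := WCPO.hom_ext fun (p : A × B) => PointedCPO.braiding_tmul p.1 p.2


/-! ### `CPO` and `CPO⊥!` as `CPO`-categories -/

/-- The hom-cpos of `CPO`: Scott-continuous functions with the pointwise order. -/
instance (X Y : ωCPO.{u}) : OmegaCompletePartialOrder (X ⟶ Y) :=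
  inferInstanceAs (OmegaCompletePartialOrder (X →𝒄 Y))

/-- `CPO` is a `CPO`-category. -/
instance : CPOCategory ωCPO.{u} where
  homCPO _ _ := inferInstance
  comp_continuous X Y Z := by
    have h (x : X) : ωScottContinuous fun p : (X →𝒄 Y) × (Y →𝒄 Z) => p.2 (p.1 x) :=
      ContinuousHom.ωScottContinuous_apply Prod.ωScottContinuous_snd
        (ContinuousHom.ωScottContinuous_apply Prod.ωScottContinuous_fst .const)
    exact .of_monotone_map_ωSup ⟨fun _ _ hp x => (h x).monotone hp,
      fun c => ContinuousHom.ext _ _ fun x => (h x).map_ωSup c⟩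

/-- The hom-cpos of `CPO⊥!`: strict Scott-continuous functions with the pointwise order. -/
instance (X Y : PointedCPO.{u}) : OmegaCompletePartialOrder (X ⟶ Y) :=
  inferInstanceAs (OmegaCompletePartialOrder (StrictHom X Y))

/-- `CPO⊥!` is a `CPO`-category. -/
instance : CPOCategory PointedCPO.{u} where
  homCPO _ _ := inferInstance
  comp_continuous X Y Z := StrictHom.continuous_of_apply (A := X) (B := Z) fun _ =>
    StrictHom.continuous_eval (A := Y) (B := Z) (P := (X ⟶ Y) × (Y ⟶ Z)) (f := fun p => p.2)
      Prod.ωScottContinuous_snd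
      (StrictHom.continuous_eval (A := X) (B := Y) (P := (X ⟶ Y) × (Y ⟶ Z)) (f := fun p => p.1)
        Prod.ωScottContinuous_fst .const)

end CPOLNL

namespace CPOLNL

/-! ### Continuity criteria -/

/-! The enrichment conditions are pointwise. Suprema in the hom-cpos of `CPO` and `CPO⊥!` are
computed argument by argument, so continuity of an operation on morphisms reduces to continuity of
evaluation, of pairing and `smash`, and of the strict extension `liftExt`. Coproducts are disjoint
sums in `CPO` and coalesced sums in `CPO⊥!`. Monoidality of the unit and counit is an identity
between elements, checked on pairs of non-bottom elements.

The substance lies in the `ω`-colimits. Projections of embeddings are unique, so in a diagram of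
embeddings of pointed cpos they compose, and the families compatible with them form the bilimit. For
a diagram `D` of pre-embeddings in `CPO`, the lifted diagram consists of embeddings; the colimit of
`D` is the bilimit of the lifted diagram with its least element removed.

What makes this a colimit is isolated in `PartialProjections`: each element of the apex has
projections in the lifted stages, is the supremum of those that are defined, and has at least one.
The mediating map to another cocone is then forced to be the supremum of the images of these
projections (`PartialProjections.isColimit`). This serves three times: for colimits in `CPO`
(`hasColimit_of_isPreEmbedding`), for colimits in `CPO⊥!`, computed on underlying cpos
(`hasColimit_of_isEmbedding`), and for preservation by products, because two such structures
multiply (`PartialProjections.prod`).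

Adequacy holds because a morphism `I ⟶ A` is an element of `A`, the morphism `⊥` being the element
`⊥`, and a smash of non-bottom elements retains both components. -/

/-- A monotone function is Scott continuous if it is bounded at the supremum of each chain by every
upper bound of its values along the chain. -/
theorem continuous_of_le {P Q : Type*} [OmegaCompletePartialOrder P] [OmegaCompletePartialOrder Q]
    {f : P → Q} (hf : Monotone f)
    (h : ∀ (c : Chain P) (b : Q), (∀ n, f (c n) ≤ b) → f (ωSup c) ≤ b) : ωScottContinuous f :=
  .of_monotone_map_ωSup ⟨hf, fun c => le_antisymm (h c _ fun n => le_ωSup (c.map ⟨f, hf⟩) n)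
    (ωSup_le _ _ fun n => hf (le_ωSup c n))⟩

/-- Suprema in hom-cpos are pointwise. With `WCPO.continuous_eval`, and the two analogues for
`PointedCPO`, this reduces each enrichment condition to continuity of an explicit formula in
elements. -/
theorem WCPO.continuous_of_apply {P : Type*} [OmegaCompletePartialOrder P] {X Y : ωCPO.{u}}
    {f : P → (X ⟶ Y)} (h : ∀ x, ωScottContinuous fun p => f p x) : ωScottContinuous f :=
  .of_monotone_map_ωSup ⟨fun _ _ hp x => (h x).monotone hp,
    fun c => WCPO.hom_ext fun x => (h x).map_ωSup c⟩

theorem WCPO.continuous_eval {P : Type*} [OmegaCompletePartialOrder P] {X Y : ωCPO.{u}}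
    {f : P → (X ⟶ Y)} (hf : ωScottContinuous f) {g : P → X} (hg : ωScottContinuous g) :
    ωScottContinuous fun p => f p (g p) :=
  ContinuousHom.ωScottContinuous_apply (f := f) hf hg

theorem PointedCPO.continuous_of_apply {P : Type*} [OmegaCompletePartialOrder P]
    {X Y : PointedCPO.{u}} {f : P → (X ⟶ Y)} (h : ∀ x, ωScottContinuous fun p => f p x) :
    ωScottContinuous f :=
  StrictHom.continuous_of_apply (A := X) (B := Y) h

theorem PointedCPO.continuous_eval {P : Type*} [OmegaCompletePartialOrder P]
    {X Y : PointedCPO.{u}} {f : P → (X ⟶ Y)} (hf : ωScottContinuous f) {g : P → X}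
    (hg : ωScottContinuous g) : ωScottContinuous fun p => f p (g p) :=
  StrictHom.continuous_eval (A := X) (B := Y) hf hg

/-! ### The adjunction between lifting and the forgetful functor -/

theorem isCPOFunctor_liftFunctor : IsCPOFunctor liftFunctor.{u} := fun X Y =>
  PointedCPO.continuous_of_apply fun _ =>
    continuous_liftExt (P := X ⟶ Y) (f := fun (f : X ⟶ Y) (x : X) => ((f x : Y) : WithBot Y))
      (continuous_coe.comp
        (WCPO.continuous_eval Prod.ωScottContinuous_fst Prod.ωScottContinuous_snd)) .const

theorem isCPOFunctor_forgetFunctor : IsCPOFunctor forgetFunctor.{u} := fun _ _ =>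
  WCPO.continuous_of_apply fun _ => PointedCPO.continuous_eval .id .const

/-- Gives access to the explicit bijection, restriction along `up` one way and strict extension the
other, on which continuity is checked. -/
theorem liftForgetAdjunction_homEquiv (X : ωCPO.{u}) (A : PointedCPO.{u}) :
    liftForgetAdjunction.homEquiv X A = liftHomEquiv X A := by
  rw [liftForgetAdjunction, Adjunction.mkOfHomEquiv_homEquiv]

theorem isCPOAdjunction_liftForgetAdjunction : IsCPOAdjunction liftForgetAdjunction.{u} where
  left_functor := isCPOFunctor_liftFunctor
  right_functor := isCPOFunctor_forgetFunctor
  homEquiv_continuous X A := by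
    rw [liftForgetAdjunction_homEquiv]
    exact WCPO.continuous_of_apply fun x =>
      PointedCPO.continuous_eval (X := liftFunctor.obj X) .id (.const (x := up x))
  homEquiv_symm_continuous X A := by
    rw [liftForgetAdjunction_homEquiv]
    exact PointedCPO.continuous_of_apply fun w =>
      continuous_liftExt (P := X ⟶ forgetFunctor.obj A) (B := A)
        (f := fun (g : X ⟶ forgetFunctor.obj A) (x : X) => (g x : forgetFunctor.obj A))
        (WCPO.continuous_eval Prod.ωScottContinuous_fst Prod.ωScottContinuous_snd) .const

theorem liftForgetAdjunction_unit_apply (X : ωCPO.{u}) (x : X) :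
    liftForgetAdjunction.unit.app X x = up x := by
  rw [liftForgetAdjunction, Adjunction.mkOfHomEquiv_unit_app]
  rfl

theorem liftForgetAdjunction_counit_up (A : PointedCPO.{u}) (a : A) :
    liftForgetAdjunction.counit.app A (up (X := forgetFunctor.obj A) a) = a := by
  rw [liftForgetAdjunction, Adjunction.mkOfHomEquiv_counit_app]
  rfl

theorem isMonoidal_unit : NatTrans.IsMonoidal liftForgetAdjunction.{u}.unit where
  unit := WCPO.hom_ext fun x => liftForgetAdjunction_unit_apply _ x
  tensor X Y := WCPO.hom_ext fun (p : X × Y) => by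
    refine (liftForgetAdjunction_unit_apply (X ⊗ Y) p).trans ((liftMu_tmul_up p.1 p.2).symm.trans ?_)
    change _ = liftMu X Y (PointedCPO.tmul (liftForgetAdjunction.unit.app X p.1)
      (liftForgetAdjunction.unit.app Y p.2))
    rw [liftForgetAdjunction_unit_apply, liftForgetAdjunction_unit_apply]

theorem isMonoidal_counit : NatTrans.IsMonoidal liftForgetAdjunction.{u}.counit where
  unit := PointedCPO.hom_ext fun i => by
    obtain rfl | rfl := PointedCPO.one_cases i
    · simp
    · exact liftForgetAdjunction_counit_up _ _
  tensor A B := PointedCPO.hom_ext_tmul fun x y => by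
    rw [ConcreteCategory.comp_apply, ConcreteCategory.comp_apply, PointedCPO.tensorHom_tmul]
    -- All maps involved are strict, so only pairs of non-bottom elements require an argument.
    obtain rfl | ⟨x, rfl⟩ := up_cases x
    · simp
    obtain rfl | ⟨y, rfl⟩ := up_cases y
    · simp
    change liftForgetAdjunction.counit.app (A ⊗ B) (liftFunctor.map _ (liftMu _ _
      (PointedCPO.tmul (up x) (up y)))) = PointedCPO.tmul _ _
    rw [liftMu_tmul_up, liftFunctor_map_up, liftForgetAdjunction_counit_up A x,
      liftForgetAdjunction_counit_up B y]
    exact liftForgetAdjunction_counit_up (A ⊗ B) _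

/-! ### `CPO⊥!` is a `CPO`-symmetric monoidal closed category -/

namespace PointedCPO

theorem ev_tmul {X Y : PointedCPO.{u}} (x : X) (h : (ihom X).obj Y) :
    (ihom.ev X).app Y (tmul x h) = app h x := by
  have : (ihom.ev X).app Y = (curryEquiv X _ Y).symm (𝟙 _) :=
    Adjunction.mkOfHomEquiv_counit_app _ _
  rw [this]
  exact curryEquiv_symm_tmul (𝟙 _) x h

/-- `MonoidalClosed.pre` is known only through its equation with evaluation; reading that equation
at `x ⊗ h` shows that it is precomposition. -/
theorem pre_app_apply {X X' : PointedCPO.{u}} (f : X' ⟶ X) (Y : PointedCPO.{u})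
    (h : (ihom X).obj Y) (x : X') :
    app ((MonoidalClosed.pre f).app Y h : (ihom X').obj Y) x = app h (f x) := by
  have := ConcreteCategory.congr_hom (MonoidalClosed.id_tensor_pre_app_comp_ev f Y) (tmul x h)
  rw [ConcreteCategory.comp_apply, ConcreteCategory.comp_apply] at this
  rwa [whiskerLeft_tmul, whiskerRight_tmul, ev_tmul, ev_tmul] at this

end PointedCPO

theorem isCPOSymmetricMonoidalClosed_pointedCPO :
    IsCPOSymmetricMonoidalClosed PointedCPO.{u} where
  tensor_continuous X X' Y Y' := PointedCPO.continuous_of_apply fun w =>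
    continuous_smash (A := X') (B := Y')
      (PointedCPO.continuous_eval Prod.ωScottContinuous_fst .const)
      (PointedCPO.continuous_eval Prod.ωScottContinuous_snd .const)
  ihom_continuous X X' Y Y' := PointedCPO.continuous_of_apply fun h =>
    StrictHom.continuous_of_apply (A := X') (B := Y') fun x => by
      -- The internal hom acts by `h ↦ p.2 ∘ h ∘ p.1`, so at fixed `h` and `x` only two evaluations
      -- at the variable `p` remain.
      have key (p : (X' ⟶ X) × (Y ⟶ Y')) :
          PointedCPO.app (X := X') (Y := Y') (((MonoidalClosed.pre p.1).app Y ≫ (ihom X').map p.2) h)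
            x = p.2 (PointedCPO.app h (p.1 x)) :=
        congrArg p.2 (PointedCPO.pre_app_apply p.1 Y h x)
      refine Eq.mpr (congrArg ωScottContinuous (funext key)) ?_
      exact PointedCPO.continuous_eval Prod.ωScottContinuous_snd
        ((StrictHom.continuous (A := X) (B := Y) h).comp
          (PointedCPO.continuous_eval Prod.ωScottContinuous_fst .const))

theorem isCPOCartesianMonoidal_ωCPO : IsCPOCartesianMonoidal ωCPO.{u} where
  prod_continuous X X' Y Y' := WCPO.continuous_of_apply fun _ =>
    Prod.ωScottContinuous.prodMk
      (WCPO.continuous_eval (X := X) (Y := X') Prod.ωScottContinuous_fst .const)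
      (WCPO.continuous_eval (X := Y) (Y := Y') Prod.ωScottContinuous_snd .const)
  lift_continuous X Y Z := WCPO.continuous_of_apply fun _ =>
    Prod.ωScottContinuous.prodMk
      (WCPO.continuous_eval (X := Z) (Y := X) Prod.ωScottContinuous_fst .const)
      (WCPO.continuous_eval (X := Z) (Y := Y) Prod.ωScottContinuous_snd .const)

/-! ### Coproducts of cpos -/

theorem continuous_pi_apply {J : Type*} {X : J → Type*} [∀ j, OmegaCompletePartialOrder (X j)]
    (j : J) : ωScottContinuous fun x : ∀ j, X j => x j :=
  .of_monotone_map_ωSup ⟨fun _ _ h => h j, fun _ => rfl⟩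

section Sigma

variable {J : Type v} {X : J → Type u} [∀ j, OmegaCompletePartialOrder (X j)]

/-- A chain in a disjoint sum lies in one of the summands. -/
theorem exists_chain_of_sigma (c : Chain (Σ j, X j)) :
    ∃ (j : J) (d : Chain (X j)), ∀ n, c n = ⟨j, d n⟩ := by
  have h (n : ℕ) : ∃ x : X (c 0).1, c n = ⟨(c 0).1, x⟩ := by
    obtain ⟨x, hx⟩ : ∃ x : X (c n).1, (⟨(c n).1, x⟩ : Σ j, X j) = c n := ⟨_, rfl⟩
    have h0 : c 0 ≤ c n := chain_le c (Nat.zero_le n)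
    -- Both sides of `h0` become variables, so that the order relation can be destructured; it only
    -- relates elements of one summand.
    generalize c n = y at h0
    generalize c 0 = z at h0
    obtain ⟨j, a, b, -⟩ := h0
    exact ⟨b, rfl⟩
  choose d hd using h
  refine ⟨_, ⟨⟨d, fun m n hmn => ?_⟩⟩, hd⟩
  have := chain_le c hmn
  rwa [hd m, hd n, Sigma.mk_le_mk_iff] at this

/-- The disjoint sum of cpos is a cpo. -/
noncomputable instance sigmaCPO : OmegaCompletePartialOrder (Σ j, X j) where
  ωSup c := ⟨_, ωSup (exists_chain_of_sigma c).choose_spec.choose⟩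
  le_ωSup c n := by
    rw [(exists_chain_of_sigma c).choose_spec.choose_spec n, Sigma.mk_le_mk_iff]
    exact le_ωSup _ n
  ωSup_le c x h := by
    have hd := (exists_chain_of_sigma c).choose_spec.choose_spec
    -- Only `hd` matters from here on, whichever summand and chain were chosen.
    generalize (exists_chain_of_sigma c).choose_spec.choose = d at *
    generalize (exists_chain_of_sigma c).choose = j at *
    have h0 := h 0
    -- An upper bound of the chain lies above its first term, hence in the same summand.
    rw [hd 0] at h0
    obtain ⟨_, _, b, _⟩ := h0
    rw [Sigma.mk_le_mk_iff]
    refine ωSup_le _ _ fun n => ?_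
    have := h n
    rwa [hd n, Sigma.mk_le_mk_iff] at this

/-- The supremum in the sum is defined through a choice; the criterion `continuous_of_le` needs only
upper bounds in the sum, so that choice is never unfolded. -/
theorem continuous_sigmaMk (j : J) : ωScottContinuous (fun x : X j => (⟨j, x⟩ : Σ j, X j)) :=
  continuous_of_le (fun _ _ h => Sigma.mk_le_mk_iff.2 h) fun c b h => by
    obtain ⟨_, _, b, _⟩ := h 0
    exact Sigma.mk_le_mk_iff.2 (ωSup_le _ _ fun n => Sigma.mk_le_mk_iff.1 (h n))

theorem continuous_sigma {Z : Type*} [OmegaCompletePartialOrder Z] {f : (Σ j, X j) → Z}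
    (hf : ∀ j, ωScottContinuous fun x : X j => f ⟨j, x⟩) : ωScottContinuous f := by
  have hmono : Monotone f := by
    rintro _ _ ⟨j, a, b, h⟩
    exact (hf j).monotone h
  refine continuous_of_le hmono fun c b h => ?_
  obtain ⟨j, d, hd⟩ := exists_chain_of_sigma c
  -- By monotonicity of `f`, this bound is all that is needed about the supremum of `c`.
  have h1 : ωSup c ≤ ⟨j, ωSup d⟩ := ωSup_le _ _ fun n => by
    rw [hd n, Sigma.mk_le_mk_iff]
    exact le_ωSup d n
  refine (hmono h1).trans (((hf j).map_ωSup d).le.trans (ωSup_le _ _ fun n => ?_))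
  have := h n
  rwa [hd n] at this

end Sigma

/-- The disjoint sum of a family of cpos, as a cofan. -/
noncomputable def WCPO.sigmaCofan {J : Type} (X : J → ωCPO.{u}) : Limits.Cofan X :=
  Limits.Cofan.mk (ωCPO.of (Σ j, X j)) fun j => 
    WCPO.homMk (X := X j) _ (continuous_sigmaMk (X := fun j => X j) j)

/-- The disjoint sum of cpos is a coproduct. -/
noncomputable def WCPO.isColimitSigmaCofan {J : Type} (X : J → ωCPO.{u}) :
    Limits.IsColimit (WCPO.sigmaCofan X) :=
  Limits.Cofan.IsColimit.mk _
    (fun t => WCPO.homMk (X := ωCPO.of (Σ j, X j)) (Y := t.pt) (fun x => t.inj x.1 x.2)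
      (continuous_sigma fun j => WCPO.continuous (t.inj j)))
    (fun _ _ => rfl)
    (fun _ _ h => WCPO.hom_ext fun (x : Σ j, X j) => ConcreteCategory.congr_hom (h x.1) x.2)

theorem hasFiniteCPOCoproducts_ωCPO : HasFiniteCPOCoproducts ωCPO.{u} := fun _ _ X =>
  ⟨_, WCPO.isColimitSigmaCofan X, fun Z => WCPO.continuous_of_apply fun (x : Σ j, X j) =>
    WCPO.continuous_eval (X := X x.1) (Y := Z) (f := fun f : ∀ j, X j ⟶ Z => f x.1)
      (continuous_pi_apply x.1) .const⟩

/-! ### Coproducts of pointed cpos -/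

section CoalescedSum

variable {J : Type v} {X : J → Type u} [∀ j, OmegaCompletePartialOrder (X j)] [∀ j, OrderBot (X j)]

variable (X) in
/-- The coalesced sum of a family of pointed cpos: the families of elements of which at most one
is different from `⊥`. -/
def CoalescedSum : Type _ := {x : ∀ j, X j // ∀ j k, x j ≠ ⊥ → x k ≠ ⊥ → j = k}

instance : OmegaCompletePartialOrder (CoalescedSum X) :=
  OmegaCompletePartialOrder.subtype _ fun c hc j k hj hk => by
    have hj' : ωSup (c.map (Pi.evalOrderHom j)) ≠ ⊥ := hj
    have hk' : ωSup (c.map (Pi.evalOrderHom k)) ≠ ⊥ := hk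
    rw [Ne, ωSup_eq_bot_iff] at hj' hk'
    push Not at hj' hk'
    obtain ⟨m, hm⟩ := hj'
    obtain ⟨n, hn⟩ := hk'
    -- If two coordinates of the supremum are non-bottom, then both are already non-bottom in one
    -- term of the chain.
    exact hc (c (max m n)) ⟨_, rfl⟩ j k
      (fun h => hm (le_bot_iff.1 (h ▸ chain_le c (le_max_left m n) j)))
      (fun h => hn (le_bot_iff.1 (h ▸ chain_le c (le_max_right m n) k)))

instance : OrderBot (CoalescedSum X) where
  bot := ⟨fun _ => ⊥, fun _ _ h => (h rfl).elim⟩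
  bot_le _ := fun _ => bot_le

open Classical in
/-- The inclusion of a summand in the coalesced sum. -/
noncomputable def coalescedInj (j : J) (x : X j) : CoalescedSum X :=
  ⟨Function.update (fun _ => ⊥) j x, fun k l hk hl => by
    have key (k : J) (hk : Function.update (fun _ => ⊥) j x k ≠ ⊥) : k = j := by
      by_contra h
      exact hk (Function.update_of_ne h _ _)
    rw [key k hk, key l hl]⟩

theorem continuous_coalescedSum_apply (j : J) :
    ωScottContinuous fun x : CoalescedSum X => x.1 j :=
  .of_monotone_map_ωSup ⟨fun _ _ h => h j, fun _ => rfl⟩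

theorem coalescedInj_val_self (j : J) (x : X j) : (coalescedInj j x).1 j = x := by
  simp [coalescedInj]

theorem coalescedInj_val_of_ne {j k : J} (h : k ≠ j) (x : X j) : (coalescedInj j x).1 k = ⊥ := by
  simp [coalescedInj, h]

/-- A Galois connection: the inclusion of a summand is left adjoint to the coordinate map, and
therefore preserves suprema. -/
theorem coalescedInj_le_iff {j : J} {x : X j} {y : CoalescedSum X} :
    coalescedInj j x ≤ y ↔ x ≤ y.1 j := by
  refine ⟨fun h => (coalescedInj_val_self j x).symm.le.trans (h j), fun h k => ?_⟩
  by_cases hk : k = j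
  · subst hk
    exact (coalescedInj_val_self k x).le.trans h
  · exact (coalescedInj_val_of_ne hk x).le.trans bot_le

theorem coalescedInj_bot (j : J) : coalescedInj j (⊥ : X j) = ⊥ :=
  le_bot_iff.1 (coalescedInj_le_iff.2 bot_le)

theorem coalescedInj_val_of_ne_bot {j : J} {x : CoalescedSum X} (h : x.1 j ≠ ⊥) :
    coalescedInj j (x.1 j) = x := by
  refine Subtype.ext (funext fun k => ?_)
  by_cases hk : k = j
  · subst hk
    exact coalescedInj_val_self _ _
  · rw [coalescedInj_val_of_ne hk]
    by_contra h'
    exact hk (x.2 k j (Ne.symm h') h)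

theorem coalescedSum_cases (x : CoalescedSum X) : x = ⊥ ∨ ∃ j a, a ≠ ⊥ ∧ x = coalescedInj j a := by
  by_cases h : ∃ j, x.1 j ≠ ⊥
  · obtain ⟨j, hj⟩ := h
    exact .inr ⟨j, _, hj, (coalescedInj_val_of_ne_bot hj).symm⟩
  · push Not at h
    exact .inl (Subtype.ext (funext h))

theorem continuous_coalescedInj (j : J) : ωScottContinuous (coalescedInj j : X j → _) :=
  continuous_of_le
    (fun _ _ h => coalescedInj_le_iff.2 (h.trans (coalescedInj_val_self j _).symm.le))
    fun _ _ h => coalescedInj_le_iff.2 (ωSup_le _ _ fun n => coalescedInj_le_iff.1 (h n))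

variable {Z : Type*} [OmegaCompletePartialOrder Z] [OrderBot Z]

open Classical in
/-- The function on the coalesced sum given by functions on the summands. -/
noncomputable def coalescedDesc (f : ∀ j, StrictHom (X j) Z) (x : CoalescedSum X) : Z :=
  if h : ∃ j, x.1 j ≠ ⊥ then f h.choose (x.1 h.choose) else ⊥

theorem coalescedDesc_bot (f : ∀ j, StrictHom (X j) Z) : coalescedDesc f ⊥ = ⊥ :=
  dif_neg fun ⟨_, h⟩ => h rfl

theorem coalescedDesc_of_ne_bot (f : ∀ j, StrictHom (X j) Z) {x : CoalescedSum X} {j : J}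
    (h : x.1 j ≠ ⊥) : coalescedDesc f x = f j (x.1 j) := by
  have h' : ∃ j, x.1 j ≠ ⊥ := ⟨j, h⟩
  rw [coalescedDesc, dif_pos h', ← x.2 j h'.choose h h'.choose_spec]

/-- Describes `coalescedDesc f x` as the least upper bound of all `f j (x.1 j)`. This removes the
choice of a non-bottom coordinate, and monotonicity and continuity follow coordinatewise. -/
theorem coalescedDesc_le_iff {f : ∀ j, StrictHom (X j) Z} {x : CoalescedSum X} {z : Z} :
    coalescedDesc f x ≤ z ↔ ∀ j, f j (x.1 j) ≤ z := by
  constructor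
  · intro h j
    by_cases hj : x.1 j = ⊥
    · rw [hj, StrictHom.map_bot]
      exact bot_le
    · rwa [← coalescedDesc_of_ne_bot f hj]
  · intro h
    by_cases h' : ∃ j, x.1 j ≠ ⊥
    · obtain ⟨j, hj⟩ := h'
      rw [coalescedDesc_of_ne_bot f hj]
      exact h j
    · rw [coalescedDesc, dif_neg h']
      exact bot_le

theorem coalescedDesc_inj (f : ∀ j, StrictHom (X j) Z) (j : J) (x : X j) :
    coalescedDesc f (coalescedInj j x) = f j x := by
  by_cases h : x = ⊥
  · rw [h, coalescedInj_bot, coalescedDesc_bot, StrictHom.map_bot]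
  · have h' : (coalescedInj j x).1 j ≠ ⊥ := by rwa [coalescedInj_val_self]
    rw [coalescedDesc_of_ne_bot f h', coalescedInj_val_self]

/-- Joint continuity serves two purposes: with `f` fixed the mediating map is a morphism, and with
`x` fixed the universal bijection is continuous. -/
theorem continuous_coalescedDesc :
    ωScottContinuous fun p : (∀ j, StrictHom (X j) Z) × CoalescedSum X => coalescedDesc p.1 p.2 := by
  have hev (j : J) : ωScottContinuous
      fun p : (∀ j, StrictHom (X j) Z) × CoalescedSum X => p.1 j (p.2.1 j) :=
    StrictHom.continuous_eval
      (f := fun p : (∀ j, StrictHom (X j) Z) × CoalescedSum X => p.1 j)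
      ((continuous_pi_apply j).comp Prod.ωScottContinuous_fst)
      ((continuous_coalescedSum_apply j).comp Prod.ωScottContinuous_snd)
  refine continuous_of_le (fun p q h => ?_) fun c b h => ?_
  · exact coalescedDesc_le_iff.2 fun j => ((hev j).monotone h).trans (coalescedDesc_le_iff.1 le_rfl j)
  · exact coalescedDesc_le_iff.2 fun j => ((hev j).map_ωSup c).le.trans
      (ωSup_le _ _ fun n => coalescedDesc_le_iff.1 (h n) j)

end CoalescedSum

namespace PointedCPO

/-- The coalesced sum of a family of pointed cpos, as a cofan. -/
noncomputable def coalescedCofan {J : Type} (X : J → PointedCPO.{u}) : Limits.Cofan X :=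
  Limits.Cofan.mk (of (CoalescedSum fun j => X j)) fun j =>
    homMk _ (continuous_coalescedInj (X := fun j => X j) j) (coalescedInj_bot j)

/-- The coalesced sum of pointed cpos is a coproduct. -/
noncomputable def isColimitCoalescedCofan {J : Type} (X : J → PointedCPO.{u}) :
    Limits.IsColimit (coalescedCofan X) :=
  Limits.Cofan.IsColimit.mk _
    (fun t => homMk (coalescedDesc (X := fun j => X j) (Z := t.pt) fun j => t.inj j)
      ((continuous_coalescedDesc (X := fun j => X j) (Z := t.pt)).comp
        (Prod.ωScottContinuous.prodMk (.const (x := fun j => t.inj j)) .id))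
      (coalescedDesc_bot _))
    (fun t j => hom_ext fun x =>
      coalescedDesc_inj (X := fun j => X j) (Z := t.pt) (fun j => t.inj j) j x)
    (fun t m h => hom_ext fun x => by
      obtain rfl | ⟨j, a, -, rfl⟩ := coalescedSum_cases (X := fun j => X j) x
      · exact (map_bot m).trans (map_bot _).symm
      · exact (ConcreteCategory.congr_hom (h j) a).trans
          (coalescedDesc_inj (X := fun j => X j) (Z := t.pt) (fun j => t.inj j) j a).symm)

end PointedCPO

theorem hasFiniteCPOCoproducts_pointedCPO : HasFiniteCPOCoproducts PointedCPO.{u} := fun _ _ X =>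
  ⟨_, PointedCPO.isColimitCoalescedCofan X, fun Z => PointedCPO.continuous_of_apply fun x =>
    (continuous_coalescedDesc (X := fun j => X j) (Z := Z)).comp
      (Prod.ωScottContinuous.prodMk .id (.const (x := x)))⟩

/-! ### Embedding-projection pairs -/

section EPPair

variable {C : Type u₁} [Category.{v₁} C] [CPOCategory C]
  {L : Type u₂} [Category.{v₂} L] [CPOCategory L]

theorem comp_mono {X Y Z : C} {f f' : X ⟶ Y} {g g' : Y ⟶ Z} (hf : f ≤ f') (hg : g ≤ g') :
    f ≫ g ≤ f' ≫ g' :=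
  (CPOCategory.comp_continuous X Y Z).monotone (show (f, g) ≤ (f', g') from ⟨hf, hg⟩)

theorem IsEPPair.comp {X Y Z : C} {e : X ⟶ Y} {p : Y ⟶ X} {e' : Y ⟶ Z} {p' : Z ⟶ Y}
    (h : IsEPPair e p) (h' : IsEPPair e' p') : IsEPPair (e ≫ e') (p' ≫ p) := by
  refine ⟨?_, ?_⟩
  · rw [Category.assoc, ← Category.assoc e', h'.1, Category.id_comp, h.1]
  · rw [Category.assoc, ← Category.assoc p]
    refine (comp_mono le_rfl (comp_mono h.2 le_rfl)).trans ?_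
    rw [Category.id_comp]
    exact h'.2

/-- `p = p ≫ e ≫ p' ≤ p'`, from `e ≫ p' = 𝟙` and `p ≫ e ≤ 𝟙`. -/
theorem IsEPPair.le {X Y : C} {e : X ⟶ Y} {p p' : Y ⟶ X} (h : IsEPPair e p)
    (h' : IsEPPair e p') : p ≤ p' := by
  have := comp_mono h.2 (le_refl p')
  rwa [Category.assoc, h'.1, Category.comp_id, Category.id_comp] at this

/-- The projection corresponding to an embedding is unique. -/
theorem IsEPPair.unique {X Y : C} {e : X ⟶ Y} {p p' : Y ⟶ X} (h : IsEPPair e p)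
    (h' : IsEPPair e p') : p = p' :=
  le_antisymm (h.le h') (h'.le h)

/-- `CPO`-functors preserve embeddings. -/
theorem IsCPOFunctor.isEmbedding_map {F : C ⥤ L} (hF : IsCPOFunctor F) {X Y : C} {e : X ⟶ Y}
    (h : IsEmbedding e) : IsEmbedding (F.map e) := by
  obtain ⟨p, h₁, h₂⟩ := h
  refine ⟨F.map p, ?_, ?_⟩
  · rw [← F.map_comp, h₁, F.map_id]
  · rw [← F.map_comp, ← F.map_id]
    exact (hF Y Y).monotone h₂

end EPPair

/-! ### Lifted cpos -/

theorem up_le_up {X : ωCPO.{u}} {x y : X} : up x ≤ up y ↔ x ≤ y := WithBot.coe_le_coe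

theorem up_injective {X : ωCPO.{u}} : Function.Injective (up : X → _) := WithBot.coe_injective

theorem exists_of_up_le {X : ωCPO.{u}} {x : X} {w : liftFunctor.obj X} (h : up x ≤ w) :
    ∃ y, w = up y ∧ x ≤ y := by
  obtain rfl | ⟨y, rfl⟩ := up_cases w
  · exact (up_ne_bot x (le_bot_iff.1 h)).elim
  · exact ⟨y, rfl, up_le_up.1 h⟩

/-- A Scott-continuous function to `Y⊥` that omits the value `⊥` is a Scott-continuous function
to `Y`. -/
theorem continuous_of_up_comp {P : Type*} [OmegaCompletePartialOrder P] {Y : ωCPO.{u}} {f : P → Y}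
    (h : ωScottContinuous fun x => up (f x)) : ωScottContinuous f :=
  continuous_of_le (fun _ _ hxy => up_le_up.1 (h.monotone hxy)) fun c _ hb =>
    up_le_up.1 ((h.map_ωSup c).le.trans (ωSup_le _ _ fun n => up_le_up.2 (hb n)))

/-! ### Cocones with partial projections -/

open Limits

/-- Partial projections for a cocone under an `ω`-diagram of cpos which exhibit the elements of the
apex as suprema of their projections. -/
structure PartialProjections {D : ℕ ⥤ ωCPO.{u}} (c : Cocone D) where
  /-- the partial projections -/
  proj (n : ℕ) : c.pt → liftFunctor.obj (D.obj n)
  continuous_proj (n : ℕ) : ωScottContinuous (proj n)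
  proj_ι (n : ℕ) (a : D.obj n) : proj n (c.ι.app n a) = up a
  map_proj_le {n m : ℕ} (h : n ⟶ m) (x : c.pt) : liftFunctor.map (D.map h) (proj n x) ≤ proj m x
  ι_le {n : ℕ} {x : c.pt} {a : D.obj n} : proj n x = up a → c.ι.app n a ≤ x
  le_of_ι_le (x b : c.pt) : (∀ n a, proj n x = up a → c.ι.app n a ≤ b) → x ≤ b
  exists_proj (x : c.pt) : ∃ n a, proj n x = up a

theorem cocone_apply {D : ℕ ⥤ ωCPO.{u}} (s : Cocone D) {n m : ℕ} (h : n ⟶ m) (a : D.obj n) :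
    s.ι.app m (D.map h a) = s.ι.app n a :=
  ConcreteCategory.congr_hom (s.w h) a

namespace PartialProjections

variable {D : ℕ ⥤ ωCPO.{u}} {c : Cocone D} (B : PartialProjections c)

/-- A projection that is defined at one stage stays defined at all later ones. This allows several
stages to be replaced by their maximum. -/
theorem exists_proj_of_le {n m : ℕ} (h : n ≤ m) {x : c.pt} {a : D.obj n} (ha : B.proj n x = up a) :
    ∃ b, B.proj m x = up b ∧ D.map (homOfLE h) a ≤ b := by
  have := B.map_proj_le (homOfLE h) x
  rw [ha, liftFunctor_map_up] at this
  exact exists_of_up_le this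

/-- The approximations in the apex of a cocone `s` of the image of an element. -/
noncomputable def descChain (s : Cocone D) (x : c.pt) : Chain (liftFunctor.obj s.pt) where
  toFun n := liftFunctor.map (s.ι.app n) (B.proj n x)
  monotone' n m h := by
    refine le_trans (le_of_eq ?_) ((PointedCPO.continuous (liftFunctor.map (s.ι.app m))).monotone
      (B.map_proj_le (homOfLE h) x))
    change liftFunctor.map (s.ι.app n) (B.proj n x) = _
    rw [← s.w (homOfLE h), Functor.map_comp, ConcreteCategory.comp_apply]

/-- The image of an element in the lifting of the apex of a cocone `s`. -/
noncomputable def descLift (s : Cocone D) (x : c.pt) : liftFunctor.obj s.pt :=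
  ωSup (B.descChain s x)

theorem le_descLift (s : Cocone D) (x : c.pt) (n : ℕ) :
    liftFunctor.map (s.ι.app n) (B.proj n x) ≤ B.descLift s x :=
  le_ωSup (B.descChain s x) n

theorem up_le_descLift (s : Cocone D) {x : c.pt} {n : ℕ} {a : D.obj n} (h : B.proj n x = up a) :
    up (s.ι.app n a) ≤ B.descLift s x := by
  have := B.le_descLift s x n
  rwa [h, liftFunctor_map_up] at this

/-- Stages at which the projection is `⊥` contribute nothing to the supremum. -/
theorem descLift_le {s : Cocone D} {x : c.pt} {b : liftFunctor.obj s.pt}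
    (h : ∀ n a, B.proj n x = up a → up (s.ι.app n a) ≤ b) : B.descLift s x ≤ b := by
  refine ωSup_le _ _ fun n => ?_
  change liftFunctor.map (s.ι.app n) (B.proj n x) ≤ b
  obtain h' | ⟨a, ha⟩ := up_cases (B.proj n x)
  · rw [h', PointedCPO.map_bot]
    exact bot_le
  · rw [ha, liftFunctor_map_up]
    exact h n a ha

theorem continuous_descLift (s : Cocone D) : ωScottContinuous (B.descLift s) := by
  have hn (n : ℕ) : ωScottContinuous fun x => liftFunctor.map (s.ι.app n) (B.proj n x) :=
    (PointedCPO.continuous _).comp (B.continuous_proj n)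
  refine continuous_of_le (fun x y h => ωSup_le _ _ fun n => ?_) fun d b h => ωSup_le _ _ fun n => ?_
  · exact ((hn n).monotone h).trans (B.le_descLift s y n)
  -- Interchange of the supremum along `d` with the supremum over the stages.
  · exact ((hn n).map_ωSup d).le.trans (ωSup_le _ _ fun k => (B.le_descLift s (d k) n).trans (h k))

/-- Some projection of `x` is defined, so the supremum is not `⊥`; hence the mediating map lands in
`s.pt` and not merely in its lifting. -/
theorem exists_descLift (s : Cocone D) (x : c.pt) : ∃ y, B.descLift s x = up y := by
  obtain ⟨n, a, h⟩ := B.exists_proj x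
  obtain ⟨y, hy, -⟩ := exists_of_up_le (B.up_le_descLift s h)
  exact ⟨y, hy⟩

/-- The function from the apex to the apex of a cocone `s`. -/
noncomputable def descFun (s : Cocone D) (x : c.pt) : s.pt := (B.exists_descLift s x).choose

theorem up_descFun (s : Cocone D) (x : c.pt) : up (B.descFun s x) = B.descLift s x :=
  (B.exists_descLift s x).choose_spec.symm

theorem descFun_ι (s : Cocone D) (n : ℕ) (a : D.obj n) : B.descFun s (c.ι.app n a) = s.ι.app n a := by
  apply up_injective
  rw [up_descFun]
  refine le_antisymm (B.descLift_le fun m b hb => ?_) (B.up_le_descLift s (B.proj_ι n a))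
  -- At stage `max n m` the projection of `c.ι.app n a` is the image of `a`, and it dominates the
  -- image of `b`. Applying `s` there compares `s.ι.app m b` with `s.ι.app n a`.
  obtain ⟨b', hb', hle⟩ := B.exists_proj_of_le (le_max_right n m) hb
  rw [← cocone_apply c (homOfLE (le_max_left n m)), B.proj_ι] at hb'
  rw [up_le_up, ← cocone_apply s (homOfLE (le_max_right n m)),
    ← cocone_apply s (homOfLE (le_max_left n m)), up_injective hb']
  exact (WCPO.continuous _).monotone hle

/-- The elements of the apex are the suprema of their projections. -/
theorem descLift_self (x : c.pt) : B.descLift c x = up x := by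
  refine le_antisymm (B.descLift_le fun n a h => up_le_up.2 (B.ι_le h)) ?_
  rw [← up_descFun, up_le_up]
  refine B.le_of_ι_le _ _ fun n a h => ?_
  rw [← up_le_up, up_descFun]
  exact B.up_le_descLift c h

/-- By `descLift_self`, `up x` is the supremum of its stages. The continuous map `liftFunctor.map f`
preserves this supremum, and its value on each stage is dictated by `s`. -/
theorem eq_descFun (s : Cocone D) {f : c.pt ⟶ s.pt} (hf : ∀ n, c.ι.app n ≫ f = s.ι.app n)
    (x : c.pt) : f x = B.descFun s x := by
  apply up_injective
  rw [up_descFun, ← liftFunctor_map_up f, ← B.descLift_self, descLift,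
    (PointedCPO.continuous (liftFunctor.map f)).map_ωSup]
  refine congrArg ωSup (DFunLike.ext _ _ fun n => ?_)
  change liftFunctor.map f (liftFunctor.map (c.ι.app n) (B.proj n x)) =
    liftFunctor.map (s.ι.app n) (B.proj n x)
  rw [← hf n, Functor.map_comp, ConcreteCategory.comp_apply]

/-- A cocone with partial projections is a colimit cocone. -/
noncomputable def isColimit : IsColimit c where
  desc s := WCPO.homMk (B.descFun s)
    (continuous_of_up_comp (by simpa only [up_descFun] using B.continuous_descLift s))
  fac s n := WCPO.hom_ext (B.descFun_ι s n)
  uniq s _ hm := WCPO.hom_ext (B.eq_descFun s hm)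

end PartialProjections

/-! ### Bilimits of `ω`-diagrams of embeddings -/

section Bilimit

variable {D : ℕ ⥤ PointedCPO.{u}} (hD : ∀ {i j : ℕ} (h : i ⟶ j), IsEmbedding (D.map h))

/-- The projections of an `ω`-diagram of embeddings. -/
noncomputable def diagProj {n m : ℕ} (h : n ≤ m) : D.obj m ⟶ D.obj n := (hD (homOfLE h)).choose

theorem isEPPair_diagProj {n m : ℕ} (h : n ≤ m) : IsEPPair (D.map (homOfLE h)) (diagProj hD h) :=
  (hD (homOfLE h)).choose_spec

theorem diagProj_map {n m : ℕ} (h : n ≤ m) (x : D.obj n) :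
    diagProj hD h (D.map (homOfLE h) x) = x :=
  ConcreteCategory.congr_hom (isEPPair_diagProj hD h).1 x

theorem map_diagProj_le {n m : ℕ} (h : n ≤ m) (x : D.obj m) :
    D.map (homOfLE h) (diagProj hD h x) ≤ x :=
  (isEPPair_diagProj hD h).2 x

theorem diagMap_diagMap {n m k : ℕ} (h : n ≤ m) (h' : m ≤ k) (x : D.obj n) :
    D.map (homOfLE h') (D.map (homOfLE h) x) = D.map (homOfLE (h.trans h')) x := by
  rw [← ConcreteCategory.comp_apply, ← D.map_comp]
  rfl

/-- The projections are chosen separately for each pair of indices; they compose because the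
projection of an embedding is unique. -/
theorem diagProj_diagProj {n m k : ℕ} (h : n ≤ m) (h' : m ≤ k) (x : D.obj k) :
    diagProj hD h (diagProj hD h' x) = diagProj hD (h.trans h') x := by
  have h₁ := (isEPPair_diagProj hD h).comp (isEPPair_diagProj hD h')
  rw [← D.map_comp] at h₁
  exact ConcreteCategory.congr_hom (h₁.unique (isEPPair_diagProj hD (h.trans h'))) x

/-- The image in the `m`-th cpo of an element of the `n`-th cpo of an `ω`-diagram of embeddings. -/
noncomputable def transition (n m : ℕ) (x : D.obj n) : D.obj m :=
  diagProj hD (le_max_right n m) (D.map (homOfLE (le_max_left n m)) x)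

/-- Any common upper index `k` may replace `max n m`: going up from `max n m` to `k` and projecting
back is the identity. -/
theorem transition_eq {n m k : ℕ} (hn : n ≤ k) (hm : m ≤ k) (x : D.obj n) :
    transition hD n m x = diagProj hD hm (D.map (homOfLE hn) x) := by
  have h : max n m ≤ k := max_le hn hm
  rw [← diagMap_diagMap (le_max_left n m) h, ← diagProj_diagProj hD (le_max_right n m) h,
    diagProj_map]
  rfl

theorem transition_self (n : ℕ) (x : D.obj n) : transition hD n n x = x := by
  rw [transition_eq hD le_rfl le_rfl, diagProj_map]

theorem transition_map {n n' : ℕ} (h : n ≤ n') (m : ℕ) (x : D.obj n) :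
    transition hD n' m (D.map (homOfLE h) x) = transition hD n m x := by
  rw [transition_eq hD (h.trans (le_max_left n' m)) (le_max_right n' m), 
    ← diagMap_diagMap h (le_max_left n' m)]
  rfl

theorem diagProj_transition (n : ℕ) {m m' : ℕ} (h : m ≤ m') (x : D.obj n) :
    diagProj hD h (transition hD n m' x) = transition hD n m x := by
  rw [transition_eq hD (le_max_left n m') (h.trans (le_max_right n m')), 
    ← diagProj_diagProj hD h (le_max_right n m')]
  rfl

/-- Let `k = max n m`. As `x n` is the projection of `x k`, embedding it into stage `k` gives an
element below `x k`; projecting to stage `m` yields the bound. -/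
theorem transition_le {x : ∀ n, D.obj n} (hx : ∀ n m (h : n ≤ m), diagProj hD h (x m) = x n)
    (n m : ℕ) : transition hD n m (x n) ≤ x m := by
  rw [← hx n _ (le_max_left n m), ← hx m _ (le_max_right n m)]
  exact (PointedCPO.continuous _).monotone (map_diagProj_le hD _ _)

theorem continuous_transition (n m : ℕ) :
    ωScottContinuous fun x : D.obj n => transition hD n m x :=
  (PointedCPO.continuous _).comp (PointedCPO.continuous _)

/-- The nonzero elements of the bilimit of an `ω`-diagram of embeddings: the families compatible
with the projections and different from `⊥`. -/
def Bilimit : Type u :=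
  {x : ∀ n, D.obj n // (∀ n m (h : n ≤ m), diagProj hD h (x m) = x n) ∧ ∃ n, x n ≠ ⊥}

instance : OmegaCompletePartialOrder (Bilimit hD) :=
  OmegaCompletePartialOrder.subtype _ fun c hc => by
    refine ⟨fun n m h => ?_, ?_⟩
    · change diagProj hD h (ωSup (c.map (Pi.evalOrderHom m))) = ωSup (c.map (Pi.evalOrderHom n))
      rw [(PointedCPO.continuous _).map_ωSup]
      exact congrArg ωSup (DFunLike.ext _ _ fun k => (hc (c k) ⟨k, rfl⟩).1 n m h)
    -- A coordinate that is non-bottom in the first term remains so in the supremum.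
    · obtain ⟨n, hn⟩ := (hc (c 0) ⟨0, rfl⟩).2
      exact ⟨n, fun h => hn (le_bot_iff.1 ((le_ωSup c 0 n).trans h.le))⟩

theorem continuous_bilimit_apply (n : ℕ) : ωScottContinuous fun x : Bilimit hD => x.1 n :=
  .of_monotone_map_ωSup ⟨fun _ _ h => h n, fun _ => rfl⟩

theorem continuous_bilimit {P : Type*} [OmegaCompletePartialOrder P] {f : P → Bilimit hD}
    (h : ∀ n, ωScottContinuous fun p => (f p).1 n) : ωScottContinuous f :=
  continuous_of_le (fun _ _ hp n => (h n).monotone hp) fun c _ hb n =>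
    ((h n).map_ωSup c).le.trans (ωSup_le _ _ fun k => hb k n)

end Bilimit

/-! ### Bilimits of lifted diagrams as colimits of cpos -/

section PreEmbeddings

variable {D : ℕ ⥤ ωCPO.{u}}
  (hD : ∀ {i j : ℕ} (h : i ⟶ j), IsEmbedding ((D ⋙ liftFunctor).map h))

/-- The elements of an `ω`-diagram of pre-embeddings as elements of the bilimit. -/
noncomputable def bilimitι (n : ℕ) (a : D.obj n) : Bilimit hD :=
  ⟨fun m => transition hD n m (up a), fun _ _ h => diagProj_transition hD n h _,
    -- The `n`-th component is `up a` itself, so the family is not constantly `⊥`.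
    n, (transition_self hD n (up a)).trans_ne (up_ne_bot a)⟩

/-- The bilimit of an `ω`-diagram of pre-embeddings as a cocone. -/
noncomputable def bilimitCocone : Cocone D where
  pt := .of (Bilimit hD)
  ι :=
    { app n := WCPO.homMk (Y := .of (Bilimit hD)) (bilimitι hD n)
        (continuous_bilimit hD fun m => (continuous_transition hD n m).comp continuous_coe)
      naturality _ _ h := WCPO.hom_ext fun a => Subtype.ext (funext fun k =>
        transition_map hD (leOfHom h) k (up a)) }

/-- The components of the elements of the bilimit are partial projections. -/
noncomputable def bilimitProjections : PartialProjections (bilimitCocone hD) where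
  proj n (x : Bilimit hD) := x.1 n
  continuous_proj := continuous_bilimit_apply hD
  proj_ι n a := transition_self hD n (up a)
  map_proj_le {n m} h (x : Bilimit hD) := by
    have := map_diagProj_le hD (leOfHom h) (x.1 m)
    rwa [x.2.1] at this
  ι_le {n} (x : Bilimit hD) a h m := by
    have := transition_le hD x.2.1 n m
    rwa [show x.1 n = up a from h] at this
  le_of_ι_le (x : Bilimit hD) (b : Bilimit hD) h n := by
    obtain h' | ⟨a, ha⟩ := up_cases (x.1 n)
    · exact h'.le.trans bot_le
    -- The `n`-th component of the image of `a` is `up a`, so the hypothesis read at index `n` is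
    -- the required inequality.
    · have := h n a ha n
      exact (ha.trans (transition_self hD n (up a)).symm).le.trans this
  exists_proj (x : Bilimit hD) := by
    obtain ⟨n, hn⟩ := x.2.2
    exact ⟨n, (up_cases (x.1 n)).resolve_left hn⟩

end PreEmbeddings

theorem exists_partialProjections (D : ℕ ⥤ ωCPO.{u})
    (hD : ∀ {i j : ℕ} (h : i ⟶ j), IsPreEmbedding liftFunctor (D.map h)) :
    ∃ c : Cocone D, Nonempty (PartialProjections c) :=
  ⟨_, ⟨bilimitProjections (D := D) hD⟩⟩

theorem hasColimit_of_isPreEmbedding (D : ℕ ⥤ ωCPO.{u})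
    (hD : ∀ {i j : ℕ} (h : i ⟶ j), IsPreEmbedding liftFunctor (D.map h)) : HasColimit D := by
  obtain ⟨c, ⟨B⟩⟩ := exists_partialProjections D hD
  exact ⟨⟨c, B.isColimit⟩⟩

/-! ### Colimits of pointed cpos -/

section Pointed

variable {D : ℕ ⥤ PointedCPO.{u}} {c : Cocone (D ⋙ forgetFunctor)} (B : PartialProjections c)

/-- The maps of `D` are strict, so the least elements of all stages have the same image, which
becomes the least element of the apex. -/
theorem cocone_bot (n : ℕ) : c.ι.app n (⊥ : D.obj n) = c.ι.app 0 (⊥ : D.obj 0) :=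
  (congrArg (c.ι.app n) (PointedCPO.map_bot (D.map (homOfLE (Nat.zero_le n)))).symm).trans
    (cocone_apply c (homOfLE (Nat.zero_le n)) (⊥ : D.obj 0))

namespace PartialProjections

/-- The apex of a cocone with partial projections under a diagram of pointed cpos is pointed. -/
abbrev orderBot : OrderBot c.pt where
  bot := c.ι.app 0 (⊥ : D.obj 0)
  bot_le x := by
    -- For any defined projection `a` of `x`, the image of `⊥` lies below the image of `a`, which
    -- lies below `x`.
    obtain ⟨n, a, h⟩ := B.exists_proj x
    rw [← cocone_bot n]
    exact ((WCPO.continuous (c.ι.app n)).monotone (bot_le (α := D.obj n))).trans (B.ι_le h)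

/-- The cocone of pointed cpos obtained from a cocone with partial projections. -/
abbrev pointedCocone : Cocone D where
  pt := letI := B.orderBot; .of c.pt
  ι :=
    { app n := letI := B.orderBot
        PointedCPO.homMk (Y := .of c.pt) (fun x => c.ι.app n x)
          (WCPO.continuous (c.ι.app n)) (cocone_bot n)
      naturality _ _ h := PointedCPO.hom_ext (cocone_apply c h) }

/-- The cocone of pointed cpos obtained from a cocone with partial projections is a colimit
cocone. -/
noncomputable def isColimitPointedCocone : IsColimit B.pointedCocone where
  desc s := PointedCPO.homMk (X := B.pointedCocone.pt)
    (fun x => B.isColimit.desc (forgetFunctor.mapCocone s) x) (WCPO.continuous _)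
    -- Strictness: the least element is the image of `⊥` from stage `0`, where the map agrees with
    -- the strict `s.ι.app 0`.
    ((ConcreteCategory.congr_hom (B.isColimit.fac (forgetFunctor.mapCocone s) 0)
      (⊥ : D.obj 0)).trans (PointedCPO.map_bot (s.ι.app 0)))
  fac s n := PointedCPO.hom_ext fun (x : D.obj n) => by
    exact ConcreteCategory.congr_hom (B.isColimit.fac (forgetFunctor.mapCocone s) n) x
  uniq s m hm := PointedCPO.hom_ext fun (x : c.pt) => by
    exact ConcreteCategory.congr_hom (B.isColimit.uniq (forgetFunctor.mapCocone s)
      (forgetFunctor.map m) fun n => congrArg forgetFunctor.map (hm n)) x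

end PartialProjections

end Pointed

/-- Both functors of the adjunction are `CPO`-functors and preserve embeddings, so the underlying
diagram consists of pre-embeddings and its colimit in `CPO` can be made pointed. -/
theorem hasColimit_of_isEmbedding (D : ℕ ⥤ PointedCPO.{u})
    (hD : ∀ {i j : ℕ} (h : i ⟶ j), IsEmbedding (D.map h)) : HasColimit D := by
  obtain ⟨c, ⟨B⟩⟩ := exists_partialProjections (D ⋙ forgetFunctor) fun h =>
    isCPOFunctor_liftFunctor.isEmbedding_map (isCPOFunctor_forgetFunctor.isEmbedding_map (hD h))
  exact ⟨⟨_, B.isColimitPointedCocone⟩⟩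

/-! ### Products of colimits -/

section Products

variable {C₁ : Type u₁} [Category.{v₁} C₁] {C₂ : Type u₂} [Category.{v₂} C₂] {D : ℕ ⥤ C₁ × C₂}

/-- Cocones under the components of a diagram in a product category form a cocone. -/
def prodCocone (c₁ : Cocone (D ⋙ CategoryTheory.Prod.fst C₁ C₂)) (c₂ : Cocone (D ⋙ CategoryTheory.Prod.snd C₁ C₂)) :
    Cocone D where
  pt := (c₁.pt, c₂.pt)
  ι :=
    { app n := (c₁.ι.app n, c₂.ι.app n)
      naturality _ _ h := Prod.ext (c₁.ι.naturality h) (c₂.ι.naturality h) }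

/-- Colimits in a product category are computed componentwise. -/
def isColimitProdCocone {c₁ : Cocone (D ⋙ CategoryTheory.Prod.fst C₁ C₂)} {c₂ : Cocone (D ⋙ CategoryTheory.Prod.snd C₁ C₂)}
    (h₁ : IsColimit c₁) (h₂ : IsColimit c₂) : IsColimit (prodCocone c₁ c₂) where
  desc s := (h₁.desc ((CategoryTheory.Prod.fst C₁ C₂).mapCocone s), h₂.desc ((CategoryTheory.Prod.snd C₁ C₂).mapCocone s))
  fac s n := Prod.ext (h₁.fac ((CategoryTheory.Prod.fst C₁ C₂).mapCocone s) n)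
    (h₂.fac ((CategoryTheory.Prod.snd C₁ C₂).mapCocone s) n)
  uniq s _ hm := Prod.ext
    (h₁.uniq ((CategoryTheory.Prod.fst C₁ C₂).mapCocone s) _ fun n => congrArg Prod.fst (hm n))
    (h₂.uniq ((CategoryTheory.Prod.snd C₁ C₂).mapCocone s) _ fun n => congrArg Prod.snd (hm n))

end Products

theorem liftMu_eq_up_iff {X Y : ωCPO.{u}} {v : liftFunctor.obj X} {w : liftFunctor.obj Y}
    {p : X × Y} : liftMu X Y (PointedCPO.tmul v w) = up (X := X ⊗ Y) p ↔ v = up p.1 ∧ w = up p.2 := by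
  obtain rfl | ⟨x, rfl⟩ := up_cases v
  · rw [PointedCPO.tmul_bot_left, PointedCPO.map_bot]
    exact ⟨fun h => (up_ne_bot _ h.symm).elim, fun h => (up_ne_bot _ h.1.symm).elim⟩
  obtain rfl | ⟨y, rfl⟩ := up_cases w
  · rw [PointedCPO.tmul_bot_right, PointedCPO.map_bot]
    exact ⟨fun h => (up_ne_bot _ h.symm).elim, fun h => (up_ne_bot _ h.2.symm).elim⟩
  rw [liftMu_tmul_up, up_injective.eq_iff, up_injective.eq_iff, up_injective.eq_iff]
  exact Prod.ext_iff

/-- The product of two cocones with partial projections has partial projections. -/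
noncomputable def PartialProjections.prod {D : ℕ ⥤ ωCPO.{u} × ωCPO.{u}}
    {c₁ : Cocone (D ⋙ CategoryTheory.Prod.fst _ _)} {c₂ : Cocone (D ⋙ CategoryTheory.Prod.snd _ _)} (B₁ : PartialProjections c₁)
    (B₂ : PartialProjections c₂) :
    PartialProjections ((MonoidalCategory.tensor ωCPO.{u}).mapCocone (prodCocone c₁ c₂)) where
  proj n (x : c₁.pt × c₂.pt) :=
    liftMu (D.obj n).1 (D.obj n).2 (PointedCPO.tmul (B₁.proj n x.1) (B₂.proj n x.2))
  continuous_proj n := (PointedCPO.continuous _).comp (continuous_smash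
    ((B₁.continuous_proj n).comp Prod.ωScottContinuous_fst)
    ((B₂.continuous_proj n).comp Prod.ωScottContinuous_snd))
  proj_ι n (a : (D.obj n).1 × (D.obj n).2) :=
    liftMu_eq_up_iff.2 ⟨B₁.proj_ι n a.1, B₂.proj_ι n a.2⟩
  map_proj_le {n m} h (x : c₁.pt × c₂.pt) := by
    obtain h' | ⟨(a : (D.obj n).1 × (D.obj n).2), ha⟩ := up_cases (X := (D.obj n).1 ⊗ (D.obj n).2)
      (liftMu (D.obj n).1 (D.obj n).2 (PointedCPO.tmul (B₁.proj n x.1) (B₂.proj n x.2)))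
    · exact ((congrArg _ h').trans (PointedCPO.map_bot _)).le.trans bot_le
    · obtain ⟨h₁, h₂⟩ := liftMu_eq_up_iff.1 ha
      obtain ⟨b₁, hb₁, hle₁⟩ := B₁.exists_proj_of_le (leOfHom h) h₁
      obtain ⟨b₂, hb₂, hle₂⟩ := B₂.exists_proj_of_le (leOfHom h) h₂
      refine (congrArg (liftFunctor.map ((D ⋙ tensor ωCPO).map h)) ha).le.trans ?_
      refine le_trans ?_ (liftMu_eq_up_iff (p := (b₁, b₂)).2 ⟨hb₁, hb₂⟩).symm.le
      exact up_le_up.2 ⟨hle₁, hle₂⟩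
  ι_le {n} (x : c₁.pt × c₂.pt) (a : (D.obj n).1 × (D.obj n).2) h :=
    ⟨B₁.ι_le (liftMu_eq_up_iff.1 h).1, B₂.ι_le (liftMu_eq_up_iff.1 h).2⟩
  le_of_ι_le (x : c₁.pt × c₂.pt) (b : c₁.pt × c₂.pt) h := by
    have h' (n : ℕ) (a₁ : (D.obj n).1) (a₂ : (D.obj n).2) (h₁ : B₁.proj n x.1 = up a₁)
        (h₂ : B₂.proj n x.2 = up a₂) : c₁.ι.app n a₁ ≤ b.1 ∧ c₂.ι.app n a₂ ≤ b.2 :=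
      h n (a₁, a₂) (liftMu_eq_up_iff.2 ⟨h₁, h₂⟩)
    constructor
    · refine B₁.le_of_ι_le _ _ fun n a ha => ?_
      -- A projection of the pair is defined only where both components are. Where `x.1` projects to
      -- `a`, `x.2` may still be undefined, so the comparison moves to a stage that is late enough
      -- for both.
      obtain ⟨m, a₂, ha₂⟩ := B₂.exists_proj x.2
      obtain ⟨b₁, hb₁, hle⟩ := B₁.exists_proj_of_le (le_max_left n m) ha
      obtain ⟨b₂, hb₂, -⟩ := B₂.exists_proj_of_le (le_max_right n m) ha₂
      rw [← cocone_apply c₁ (homOfLE (le_max_left n m))]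
      exact ((WCPO.continuous _).monotone hle).trans (h' _ b₁ b₂ hb₁ hb₂).1
    · refine B₂.le_of_ι_le _ _ fun n a ha => ?_
      obtain ⟨m, a₁, ha₁⟩ := B₁.exists_proj x.1
      obtain ⟨b₂, hb₂, hle⟩ := B₂.exists_proj_of_le (le_max_left n m) ha
      obtain ⟨b₁, hb₁, -⟩ := B₁.exists_proj_of_le (le_max_right n m) ha₁
      rw [← cocone_apply c₂ (homOfLE (le_max_left n m))]
      exact ((WCPO.continuous _).monotone hle).trans (h' _ b₁ b₂ hb₁ hb₂).2
  exists_proj (x : c₁.pt × c₂.pt) := by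
    obtain ⟨n, a, ha⟩ := B₁.exists_proj x.1
    obtain ⟨m, b, hb⟩ := B₂.exists_proj x.2
    obtain ⟨a', ha', -⟩ := B₁.exists_proj_of_le (le_max_left n m) ha
    obtain ⟨b', hb', -⟩ := B₂.exists_proj_of_le (le_max_right n m) hb
    exact ⟨max n m, ((a', b') : (D.obj (max n m)).1 × (D.obj (max n m)).2),
      liftMu_eq_up_iff.2 ⟨ha', hb'⟩⟩

/-- Preservation may be tested on a single colimit cocone, here the componentwise one, whose image
is a colimit by `PartialProjections.prod`. -/
theorem preservesColimit_tensor (D : ℕ ⥤ ωCPO.{u} × ωCPO.{u})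
    (hD : ∀ {i j : ℕ} (h : i ⟶ j),
      IsPreEmbedding liftFunctor (D.map h).1 ∧ IsPreEmbedding liftFunctor (D.map h).2) :
    PreservesColimit D (MonoidalCategory.tensor ωCPO.{u}) := by
  obtain ⟨c₁, ⟨B₁⟩⟩ := exists_partialProjections (D ⋙ CategoryTheory.Prod.fst _ _) fun h => (hD h).1
  obtain ⟨c₂, ⟨B₂⟩⟩ := exists_partialProjections (D ⋙ CategoryTheory.Prod.snd _ _) fun h => (hD h).2
  exact preservesColimit_of_preserves_colimit_cocone
    (isColimitProdCocone B₁.isColimit B₂.isColimit) (B₁.prod B₂).isColimit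

/-! ### The least element and computational adequacy -/

/-- The one-element cpo is an e-initial object of `CPO⊥!`. -/
def eInitialPUnit : EInitial PointedCPO.{u} where
  obj := .of PUnit
  isInitial := IsInitial.ofUniqueHom (fun _ => PointedCPO.homMk (fun _ => ⊥) .const rfl)
    fun _ f => PointedCPO.hom_ext fun _ => PointedCPO.map_bot f
  isEmbedding {_} f := ⟨PointedCPO.homMk (fun _ => ⊥) .const rfl,
    PointedCPO.hom_ext fun _ => rfl, fun _ => (PointedCPO.map_bot f).le.trans bot_le⟩

/-- For any e-initial object, the second factor is the constant `⊥` by initiality, so the choice of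
projection in the first factor is irrelevant. -/
theorem botHom_apply (Z : EInitial PointedCPO.{u}) (A B : PointedCPO.{u}) (a : A) :
    Z.botHom A B a = ⊥ := by
  have h : Z.isInitial.to B = PointedCPO.homMk (fun _ => ⊥) .const rfl := Z.isInitial.hom_ext _ _
  rw [EInitial.botHom, h]
  rfl

/-- A strict map out of `I` is determined by its value at `one`, and the value of `⊥` there is `⊥`.
-/
theorem apply_one_ne_bot (Z : EInitial PointedCPO.{u}) {A : PointedCPO.{u}} {f : 𝟙_ _ ⟶ A}
    (hf : f ≠ Z.botHom _ _) : f PointedCPO.one ≠ ⊥ := fun h =>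
  hf (PointedCPO.hom_ext fun i => by
    rw [botHom_apply]
    obtain rfl | rfl := PointedCPO.one_cases i
    · exact PointedCPO.map_bot f
    · exact h)

theorem le_of_apply_one_le {A : PointedCPO.{u}} {f g : 𝟙_ PointedCPO.{u} ⟶ A}
    (h : f PointedCPO.one ≤ g PointedCPO.one) : f ≤ g := fun i => by
  obtain rfl | rfl := PointedCPO.one_cases i
  · exact (PointedCPO.map_bot f).le.trans bot_le
  · exact h

theorem le_and_le_of_tmul_le {A B : PointedCPO.{u}} {a a' : A} {b b' : B} (ha : a ≠ ⊥) (hb : b ≠ ⊥)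
    (ha' : a' ≠ ⊥) (hb' : b' ≠ ⊥) (h : PointedCPO.tmul a b ≤ PointedCPO.tmul a' b') :
    a ≤ a' ∧ b ≤ b' := by
  have h' : (smash a b).1 ≤ (smash a' b').1 := h
  rwa [smash_val_of_ne ha hb, smash_val_of_ne ha' hb'] at h'

theorem isCPOLNLModel_liftForgetAdjunction : IsCPOLNLModel liftForgetAdjunction.{u} where
  linear := isCPOSymmetricMonoidalClosed_pointedCPO
  linear_coproducts := hasFiniteCPOCoproducts_pointedCPO
  cartesian := isCPOCartesianMonoidal_ωCPO
  cartesian_coproducts := hasFiniteCPOCoproducts_ωCPO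
  adjunction := isCPOAdjunction_liftForgetAdjunction
  unit_monoidal := isMonoidal_unit
  counit_monoidal := isMonoidal_counit
  eInitial := ⟨eInitialPUnit⟩
  colimits_embeddings := hasColimit_of_isEmbedding
  colimits_preEmbeddings := hasColimit_of_isPreEmbedding
  prod_preserves := preservesColimit_tensor

theorem isComputationallyAdequate_liftForgetAdjunction :
    IsComputationallyAdequate liftForgetAdjunction.{u} where
  toIsCPOLNLModel := isCPOLNLModel_liftForgetAdjunction
  id_ne_bot Z h := PointedCPO.top_ne_bot
    ((ConcreteCategory.congr_hom h PointedCPO.one).trans (botHom_apply Z _ _ _))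
  tensor_reflects Z A B f₁ g₁ f₂ g₂ hf₁ hg₁ hf₂ hg₂ h := by
    -- The pointwise order at `one ⊗ one` compares the smashes of the elements that represent the
    -- four morphisms.
    have h' := h (PointedCPO.tmul PointedCPO.one PointedCPO.one)
    have h'' : PointedCPO.tmul (f₁ PointedCPO.one) (f₂ PointedCPO.one) ≤
        PointedCPO.tmul (g₁ PointedCPO.one) (g₂ PointedCPO.one) := by
      rw [← PointedCPO.tensorHom_tmul, ← PointedCPO.tensorHom_tmul]
      exact h'
    obtain ⟨h₁, h₂⟩ := le_and_le_of_tmul_le (apply_one_ne_bot Z hf₁) (apply_one_ne_bot Z hf₂)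
      (apply_one_ne_bot Z hg₁) (apply_one_ne_bot Z hg₂) h''
    exact ⟨le_of_apply_one_le h₁, le_of_apply_one_le h₂⟩

end CPOLNL

theorem mainTheorem11 :
    CPOLNL.IsCPOLNLModel CPOLNL.liftForgetAdjunction.{u} ∧
      CPOLNL.IsComputationallyAdequate CPOLNL.liftForgetAdjunction.{u} :=
  ⟨CPOLNL.isCPOLNLModel_liftForgetAdjunction,
    CPOLNL.isComputationallyAdequate_liftForgetAdjunction⟩
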